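/- Let $\mathbb{D}$ be the open unit disc and $\mathbb{T}$ the unit circle. Let $H^2$ be the Hilbert space of holomorphic functions $f(z)=\sum_{k\ge 0}a_kz^k$ on $\mathbb{D}$ with $\|f\|^2=\sum_{k\ge 0}|a_k|^2<\infty$. For $f\in H^2\setminus\{0\}$ and $n\ge 0$, let $Q_n(1/f)$ be the optimal polynomial approximant of order $n$ of $1/f$, that is, the unique polynomial $Q$ of degree at most $n$ that minimizes $\|qf-1\|$ over all complex polynomials $q$ of degree at most $n$. For a closed set $E\subset\mathbb{T}$, let $C(E)$ be the space of continuous functions $g:E\to\mathbb{C}$, and let $\mathcal{U}_E$ be the set of all $f\in H^2\setminus\{0\}$ with the following property: for every $g\in C(E)$ there are indices $m_1<m_2<\cdots$ such that $Q_{m_s}(1/f)\to g$ uniformly on $E$ as $s\to\infty$. **Theorem.** If $E\subset\mathbb{T}$ is a closed set of Lebesgue (arc length) measure zero, then $\mathcal{U}_E$ is a dense $G_\delta$ subset of $H^2$ (with respect to the norm topology). -/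

import Mathlib

open Filter Topology Complex.UnitDisc

noncomputable section

namespace Hardy

/-- Extension by zero of a function on the open unit disc to the whole plane. -/
def extend (f : 𝔻 → ℂ) : ℂ → ℂ := Function.extend Complex.UnitDisc.coe f 0

/-- `f : 𝔻 → ℂ` is holomorphic on the open unit disc. -/
def IsHolomorphic (f : 𝔻 → ℂ) : Prop :=
  DifferentiableOn ℂ (extend f) (Metric.ball 0 1)

/-- The `k`-th Taylor coefficient `f⁽ᵏ⁾(0) / k!` of a function on the disc. -/
def taylorCoeff (f : 𝔻 → ℂ) (k : ℕ) : ℂ := iteratedDeriv k (extend f) 0 / (k.factorial : ℂ)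

/-- Membership in `H²`: holomorphic on the disc, with square-summable Taylor coefficients. -/
def IsHardy (f : 𝔻 → ℂ) : Prop :=
  IsHolomorphic f ∧ Summable fun k => ‖taylorCoeff f k‖ ^ 2

theorem extend_coe (f : 𝔻 → ℂ) (z : 𝔻) : extend f z = f z :=
  Complex.UnitDisc.coe_injective.extend_apply f 0 z

theorem hasSum_taylorCoeff {f : 𝔻 → ℂ} (hf : IsHolomorphic f) (z : 𝔻) :
    HasSum (fun k => taylorCoeff f k * (z : ℂ) ^ k) (f z) := by
  have hz : (z : ℂ) ∈ Metric.ball (0 : ℂ) 1 := by simpa using z.norm_lt_one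
  have h := Complex.hasSum_taylorSeries_on_ball hf hz
  rw [extend_coe f z] at h
  convert! h using 2 with k
  simp only [taylorCoeff, smul_eq_mul, sub_zero]
  ring

/-- A convergent power series on the disc defines a holomorphic function, and its coefficients
are the Taylor coefficients. -/
theorem of_hasSum {f : 𝔻 → ℂ} {a : ℕ → ℂ}
    (h : ∀ z : 𝔻, HasSum (fun k => a k * (z : ℂ) ^ k) (f z)) :
    IsHolomorphic f ∧ taylorCoeff f = a := by
  have hrad : (1 : ENNReal) ≤ (FormalMultilinearSeries.ofScalars ℂ a).radius := by
    refine ENNReal.le_of_forall_nnreal_lt fun r hr => ?_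
    have hr1 : (r : ℝ) < 1 := by exact_mod_cast hr
    apply FormalMultilinearSeries.le_radius_of_summable_norm
    have hs := (h (Complex.UnitDisc.mk ((r : ℝ) : ℂ) (by simpa using hr1))).summable.norm
    simpa using hs
  have hball : HasFPowerSeriesOnBall (extend f) (FormalMultilinearSeries.ofScalars ℂ a) 0 1 := by
    refine ⟨hrad, one_pos, fun {y} hy => ?_⟩
    have hy1 : ‖y‖ < 1 := by simpa [Metric.mem_eball, edist_eq_enorm_sub, enorm] using! hy
    have hs := h (Complex.UnitDisc.mk y hy1)
    rw [← extend_coe f, Complex.UnitDisc.coe_mk] at hs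
    rw [zero_add]
    simpa [FormalMultilinearSeries.ofScalars_apply_eq, mul_comm] using hs
  have hd : IsHolomorphic f := by
    have := hball.differentiableOn
    have he : Metric.eball (0 : ℂ) 1 = Metric.ball 0 1 := by
      rw [← ENNReal.ofReal_one, Metric.eball_ofReal]
    rwa [he] at this
  refine ⟨hd, ?_⟩
  have hat : AnalyticAt ℂ (extend f) 0 := hball.analyticAt
  have := hat.hasFPowerSeriesAt.eq_formalMultilinearSeries hball.hasFPowerSeriesAt
  exact FormalMultilinearSeries.ofScalars_series_injective ℂ ℂ this

theorem isHardy_of_hasSum {f : 𝔻 → ℂ} {a : ℕ → ℂ} (ha : Summable fun k => ‖a k‖ ^ 2)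
    (h : ∀ z : 𝔻, HasSum (fun k => a k * (z : ℂ) ^ k) (f z)) : IsHardy f := by
  obtain ⟨h1, h2⟩ := of_hasSum h
  exact ⟨h1, by rwa [h2]⟩

theorem memlp_iff {a : ℕ → ℂ} :
    Memℓp (E := fun _ : ℕ => ℂ) a 2 ↔ Summable fun k => ‖a k‖ ^ 2 := by
  rw [memℓp_gen_iff (by norm_num)]
  simp

theorem taylorCoeff_add {f g : 𝔻 → ℂ} (hf : IsHolomorphic f) (hg : IsHolomorphic g) :
    IsHolomorphic (f + g) ∧ taylorCoeff (f + g) = taylorCoeff f + taylorCoeff g :=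
  of_hasSum fun z => by
    simpa [add_mul] using (hasSum_taylorCoeff hf z).add (hasSum_taylorCoeff hg z)

theorem taylorCoeff_smul (c : ℂ) {f : 𝔻 → ℂ} (hf : IsHolomorphic f) :
    IsHolomorphic (c • f) ∧ taylorCoeff (c • f) = c • taylorCoeff f :=
  of_hasSum fun z => by
    simpa [mul_assoc] using (hasSum_taylorCoeff hf z).mul_left c

theorem IsHardy.add {f g : 𝔻 → ℂ} (hf : IsHardy f) (hg : IsHardy g) : IsHardy (f + g) := by
  obtain ⟨h1, h2⟩ := taylorCoeff_add hf.1 hg.1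
  exact ⟨h1, by rw [h2]; exact memlp_iff.1 ((memlp_iff.2 hf.2).add (memlp_iff.2 hg.2))⟩

theorem IsHardy.smul (c : ℂ) {f : 𝔻 → ℂ} (hf : IsHardy f) : IsHardy (c • f) := by
  obtain ⟨h1, h2⟩ := taylorCoeff_smul c hf.1
  exact ⟨h1, by rw [h2]; exact memlp_iff.1 ((memlp_iff.2 hf.2).const_smul c)⟩

theorem isHardy_zero : IsHardy 0 :=
  isHardy_of_hasSum (a := 0) (by simp) fun z => by simp

/-- The constant function `1` belongs to `H²`. -/
theorem isHardy_one : IsHardy 1 := by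
  refine isHardy_of_hasSum (a := fun k => if k = 0 then 1 else 0) ?_ fun z => ?_
  · refine summable_of_ne_finset_zero (s := {0}) fun k hk => ?_
    have hk0 : k ≠ 0 := by simpa using hk
    simp [hk0]
  · have := hasSum_ite_eq (0 : ℕ) (1 : ℂ)
    convert! this using 2 with k
    by_cases hk : k = 0 <;> simp [hk]

/-- `H²` is invariant under multiplication by the coordinate function. -/
theorem IsHardy.shift {f : 𝔻 → ℂ} (hf : IsHardy f) : IsHardy fun z => (z : ℂ) * f z := by
  refine isHardy_of_hasSum (a := fun k => if k = 0 then 0 else taylorCoeff f (k - 1)) ?_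
    fun z => ?_
  · rw [← summable_nat_add_iff 1]
    simpa using hf.2
  · have := (hasSum_taylorCoeff hf.1 z).mul_left (z : ℂ)
    rw [← hasSum_nat_add_iff' 1]
    convert! this using 1
    · funext k
      simp
      ring
    · simp

/-- The vector space `H²`, as a subspace of the space of all functions on the disc. -/
def hardySubmodule : Submodule ℂ (𝔻 → ℂ) where
  carrier := {f | IsHardy f}
  zero_mem' := isHardy_zero
  add_mem' := IsHardy.add
  smul_mem' c _ hf := hf.smul c

/-- The Hardy space `H²`. It is a type of its own, so that it carries the topology of the `H²` norm
defined below and not the topology of pointwise convergence. -/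
def H2 : Type := hardySubmodule

instance : AddCommGroup H2 := inferInstanceAs (AddCommGroup hardySubmodule)

instance : Module ℂ H2 := inferInstanceAs (Module ℂ hardySubmodule)

namespace H2

/-- The function on the disc underlying an element of `H²`. -/
def fn (f : H2) : 𝔻 → ℂ := Subtype.val f

/-- An element of `H²` from a function on the disc. -/
def mk (f : 𝔻 → ℂ) (hf : IsHardy f) : H2 := ⟨f, hf⟩

theorem isHardy (f : H2) : IsHardy f.fn := Subtype.property f

theorem ext {f g : H2} (h : ∀ z, f.fn z = g.fn z) : f = g := Subtype.ext (funext h)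

/-- The linear map taking a function in `H²` to its sequence of Taylor coefficients in `ℓ²`. -/
def coeffs : H2 →ₗ[ℂ] lp (fun _ : ℕ => ℂ) 2 where
  toFun f := ⟨taylorCoeff f.fn, memlp_iff.2 f.isHardy.2⟩
  map_add' f g := Subtype.ext (taylorCoeff_add f.isHardy.1 g.isHardy.1).2
  map_smul' c f := Subtype.ext (taylorCoeff_smul c f.isHardy.1).2

theorem coeffs_injective : Function.Injective coeffs := fun f g h => by
  refine ext fun z => ?_
  have h' : taylorCoeff f.fn = taylorCoeff g.fn := congrArg Subtype.val h
  have h1 := hasSum_taylorCoeff f.isHardy.1 z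
  rw [h'] at h1
  exact h1.unique (hasSum_taylorCoeff g.isHardy.1 z)

/-- The norm on `H²`: the `ℓ²` norm of the Taylor coefficients. -/
instance : NormedAddCommGroup H2 :=
  NormedAddCommGroup.induced H2 (lp (fun _ : ℕ => ℂ) 2) coeffs coeffs_injective

instance : InnerProductSpace ℂ H2 := InnerProductSpace.induced coeffs

theorem norm_sq_eq (f : H2) : ‖f‖ ^ 2 = ∑' k, ‖taylorCoeff f.fn k‖ ^ 2 := by
  have h := lp.norm_rpow_eq_tsum (p := 2) (by norm_num) (coeffs f)
  simpa using! h

/-- The constant function `1` in `H²`. -/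
def one : H2 := mk 1 isHardy_one

/-- The product of a polynomial and a function in `H²` is in `H²`. -/
theorem isHardy_polyMul (q : Polynomial ℂ) (f : H2) :
    IsHardy fun z => q.eval (z : ℂ) * f.fn z := by
  induction q using Polynomial.induction_on' with
  | add p q hp hq => simpa [add_mul] using! hp.add hq
  | monomial n c =>
    have h : IsHardy fun z => (z : ℂ) ^ n * f.fn z := by
      induction n with
      | zero => simpa using f.isHardy
      | succ n ih => simpa [pow_succ', mul_assoc] using ih.shift
    simpa [mul_assoc] using! h.smul c

/-- The product `q f ∈ H²` of a polynomial `q` and `f ∈ H²`. -/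
def polyMul (q : Polynomial ℂ) (f : H2) : H2 :=
  mk (fun z => q.eval (z : ℂ) * f.fn z) (isHardy_polyMul q f)

theorem fn_add (f g : H2) (z : 𝔻) : (f + g).fn z = f.fn z + g.fn z := rfl

theorem fn_smul (c : ℂ) (f : H2) (z : 𝔻) : (c • f).fn z = c * f.fn z := rfl

/-- Multiplication of `f ∈ H²` by polynomials, as a linear map in the polynomial. -/
def polyMulLin (f : H2) : Polynomial ℂ →ₗ[ℂ] H2 where
  toFun q := polyMul q f
  map_add' p q := ext fun z => by
    rw [fn_add]
    exact (congrArg (· * f.fn z) Polynomial.eval_add).trans (add_mul _ _ _)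
  map_smul' c q := ext fun z => by
    rw [RingHom.id_apply, fn_smul]
    exact (congrArg (· * f.fn z) (Polynomial.eval_smul c q (z : ℂ))).trans (mul_assoc _ _ _)

/-- A non-zero function in `H²` is not annihilated by a non-zero polynomial. -/
theorem polyMul_injective {f : H2} (hf : f ≠ 0) : Function.Injective (polyMulLin f) := by
  rw [injective_iff_map_eq_zero]
  intro q hq
  by_contra hq0
  apply hf
  have han : AnalyticOnNhd ℂ (extend f.fn) (Metric.ball 0 1) :=
    f.isHardy.1.analyticOnNhd Metric.isOpen_ball
  have hzero : ∀ᶠ z in 𝓝[≠] (0 : ℂ), extend f.fn z = 0 := by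
    have h1 : ∀ᶠ z in 𝓝[≠] (0 : ℂ), z ∈ Metric.ball (0 : ℂ) 1 :=
      nhdsWithin_le_nhds (Metric.ball_mem_nhds 0 one_pos)
    have h2 : ∀ᶠ z in 𝓝[≠] (0 : ℂ), z ∉ ((q.roots.toFinset : Set ℂ) \ {0}) :=
      nhdsWithin_le_nhds (((q.roots.toFinset.finite_toSet.subset
        Set.sdiff_subset).isClosed.isOpen_compl).mem_nhds (by simp))
    filter_upwards [h1, h2, self_mem_nhdsWithin] with z hz1 hz2 hz3
    have hz : ‖z‖ < 1 := by simpa using hz1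
    have hv : q.eval z * f.fn (Complex.UnitDisc.mk z hz) = 0 :=
      congrArg (fun g : H2 => g.fn (Complex.UnitDisc.mk z hz)) hq
    have hne : q.eval z ≠ 0 := by
      intro h0
      apply hz2
      simp only [Set.mem_sdiff, Finset.mem_coe, Multiset.mem_toFinset, Set.mem_singleton_iff]
      exact ⟨(Polynomial.mem_roots hq0).2 h0, hz3⟩
    have h3 := (mul_eq_zero.1 hv).resolve_left hne
    rwa [← extend_coe f.fn, Complex.UnitDisc.coe_mk] at h3
  have heq := han.eqOn_zero_of_preconnected_of_frequently_eq_zero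
    (convex_ball (0 : ℂ) 1).isPreconnected (Metric.mem_ball_self one_pos) hzero.frequently
  refine ext fun z => ?_
  have h4 := heq (show (z : ℂ) ∈ Metric.ball (0 : ℂ) 1 by simpa using z.norm_lt_one)
  rw [extend_coe] at h4
  exact h4

end H2

/-- `Q` is an optimal polynomial approximant of order `n` of `1 / f`: it minimizes
`‖q f - 1‖` in `H²` over all polynomials `q` of degree at most `n`. -/
def IsOPA (f : H2) (n : ℕ) (Q : Polynomial ℂ) : Prop :=
  Q.natDegree ≤ n ∧
    ∀ q : Polynomial ℂ, q.natDegree ≤ n →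
      ‖H2.polyMul Q f - H2.one‖ ≤ ‖H2.polyMul q f - H2.one‖

/-- The space of products `q f`, with `q` a polynomial of degree at most `n`. -/
def polySpan (f : H2) (n : ℕ) : Submodule ℂ H2 :=
  (Polynomial.degreeLE ℂ n).map (H2.polyMulLin f)

theorem mem_polySpan {f g : H2} {n : ℕ} :
    g ∈ polySpan f n ↔ ∃ q : Polynomial ℂ, q.natDegree ≤ n ∧ H2.polyMul q f = g := by
  simp only [polySpan, Submodule.mem_map, Polynomial.mem_degreeLE,
    ← Polynomial.natDegree_le_iff_degree_le]
  rfl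

instance (f : H2) (n : ℕ) : FiniteDimensional ℂ (polySpan f n) := by
  have : FiniteDimensional ℂ (Polynomial.degreeLE ℂ (n : WithBot ℕ)) := by
    rw [Polynomial.degreeLE_eq_span_X_pow]
    exact FiniteDimensional.span_of_finite ℂ (Finset.finite_toSet _)
  unfold polySpan
  infer_instance

/-- `Q` is an optimal approximant if and only if `Q f` is the orthogonal projection of `1`. -/
theorem isOPA_iff {f : H2} {n : ℕ} {Q : Polynomial ℂ} :
    IsOPA f n Q ↔
      Q.natDegree ≤ n ∧ H2.polyMul Q f = (polySpan f n).starProjection H2.one := by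
  refine and_congr_right fun hQ => ?_
  have hmem : H2.polyMul Q f ∈ polySpan f n := mem_polySpan.2 ⟨Q, hQ, rfl⟩
  have hmin := (polySpan f n).starProjection_minimal (y := H2.one)
  constructor
  · intro h
    refine ((polySpan f n).eq_starProjection_of_mem_of_inner_eq_zero hmem ?_).symm
    refine ((polySpan f n).norm_eq_iInf_iff_inner_eq_zero hmem).1 (le_antisymm ?_ ?_)
    · refine le_ciInf fun w => ?_
      obtain ⟨q, hq, hw⟩ := mem_polySpan.1 w.2
      rw [← hw, norm_sub_rev, norm_sub_rev H2.one]
      exact h q hq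
    · exact ciInf_le ⟨0, by rintro _ ⟨w, rfl⟩; exact norm_nonneg _⟩
        (⟨_, hmem⟩ : polySpan f n)
  · intro h q hq
    rw [h, norm_sub_rev, hmin, norm_sub_rev]
    exact ciInf_le ⟨0, by rintro _ ⟨w, rfl⟩; exact norm_nonneg _⟩
      (⟨_, mem_polySpan.2 ⟨q, hq, rfl⟩⟩ : polySpan f n)

theorem exists_isOPA (f : H2) (n : ℕ) : ∃ Q, IsOPA f n Q := by
  obtain ⟨Q, hQ, h⟩ := mem_polySpan.1 ((polySpan f n).starProjection_apply_mem H2.one)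
  exact ⟨Q, isOPA_iff.2 ⟨hQ, h⟩⟩

theorem IsOPA.unique {f : H2} (hf : f ≠ 0) {n : ℕ} {P Q : Polynomial ℂ}
    (hP : IsOPA f n P) (hQ : IsOPA f n Q) : P = Q :=
  H2.polyMul_injective hf ((isOPA_iff.1 hP).2.trans (isOPA_iff.1 hQ).2.symm)

/-- The optimal polynomial approximant `Q_n(1 / f)` of order `n` of `1 / f`; it is the unique
one if `f ≠ 0`. -/
def opa (f : H2) (n : ℕ) : Polynomial ℂ := (exists_isOPA f n).choose

theorem isOPA_opa (f : H2) (n : ℕ) : IsOPA f n (opa f n) := (exists_isOPA f n).choose_spec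

/-- The class of non-zero `f ∈ H²` with universal optimal polynomial approximants on `E`: each
continuous function on `E` is the uniform limit on `E` of a subsequence of `Q_n(1 / f)`. -/
def universalOPA (E : Set Circle) : Set H2 :=
  {f | f ≠ 0 ∧ ∀ g : C(E, ℂ), ∃ m : ℕ → ℕ, StrictMono m ∧
    TendstoUniformly (fun (s : ℕ) (z : E) => (opa f (m s)).eval ((z : Circle) : ℂ)) g atTop}

/-- Arc length (Lebesgue) outer measure on the unit circle, computed in the parametrization
`t ↦ exp (i t)`, `0 ≤ t < 2π`. -/
def arcLength (E : Set Circle) : ENNReal :=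
  MeasureTheory.volume {t : ℝ | t ∈ Set.Ico 0 (2 * Real.pi) ∧ Circle.exp t ∈ E}

end Hardy

end

noncomputable section

namespace Hardy

open Metric Real

/-! ### Circle averages of functions in the disc algebra -/

/-! The proof is a Baire category argument in the complete space `H²`. Since `C(E)` is separable,
the universal class is a countable intersection of sets `nearOPA`, each requiring some `Q_n(1/f)`
with `n ≥ N` to lie within `ε` of a given `g`. These sets are open because the coefficients of
`Q_n(1/f)` solve a Gram system that is invertible for `f ≠ 0`, so they depend continuously on `f`
(`continuousOn_opaOn`).

Density rests on an explicit family. If `B` is a finite Blaschke product and `P` a polynomial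
without zeros in the closed disc, then the projection of `1` onto `B H²` is `conj (B 0) • B`, up to
the normalization of `B`; hence the optimal approximant of `P / B`, the reciprocal of `B / P`, is a
constant multiple of `P` for all `n ≥ deg P` (`isOPA_blaschke_div`). Polynomials `q = rootPoly s *
F`, with zeros neither on the circle nor at the origin and with `F` zero-free on the closed disc,
are dense. With `S = reflectedPoly s * F`, the quotient `q / (S P)` is of the form `B / P`. It is
close to `q` when `1 / (S P)` is close to `1` in `L²`, and its optimal approximant is close to `g`
on `E` when `S P` is close to a prescribed function there.

Such a `P` exists because `E` is null (`IsNullCompact.exists_zeroFree`): `S P` is modelled on `exp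
d`, with `d` in the disc algebra, uniformly bounded, small in `L²` and near a logarithm of the
prescribed function on `E`. Nullity is used twice: for peak functions close to `1` on `E` yet small
in `L²` (`IsNullCompact.exists_peak`), and for the logarithm, since a differentiable function maps
null sets to null sets (`IsNullCompact.exists_exp_near`). -/

theorem diffContOnCl_continuousOn {F : ℂ → ℂ} (hF : DiffContOnCl ℂ F (ball 0 1)) :
    ContinuousOn F (closedBall 0 1) := by
  simpa [closure_ball (0 : ℂ) one_ne_zero] using hF.continuousOn

theorem circleIntegrable_of_continuousOn {E : Type*} [NormedAddCommGroup E] {F : ℂ → E}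
    (hF : ContinuousOn F (closedBall 0 1)) : CircleIntegrable F 0 1 :=
  (hF.mono sphere_subset_closedBall).circleIntegrable zero_le_one

theorem circleAverage_eq_zero_value {F : ℂ → ℂ} (hF : DiffContOnCl ℂ F (ball 0 1)) :
    circleAverage F 0 1 = F 0 :=
  DiffContOnCl.circleAverage (by simpa using hF)

theorem circleAverage_re {F : ℂ → ℂ} (hF : DiffContOnCl ℂ F (ball 0 1)) :
    circleAverage (fun z => (F z).re) 0 1 = (F 0).re := by
  rw [← circleAverage_eq_zero_value hF]
  exact Complex.reCLM.circleAverage_comp_comm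
    (circleIntegrable_of_continuousOn (diffContOnCl_continuousOn hF))

/-- The circle average of `‖F‖ ^ 2`. -/
def meanSq (F : ℂ → ℂ) : ℝ := circleAverage (fun z => ‖F z‖ ^ 2) 0 1

theorem circleIntegrable_norm_sq {F : ℂ → ℂ} (hF : ContinuousOn F (closedBall 0 1)) :
    CircleIntegrable (fun z => ‖F z‖ ^ 2) 0 1 :=
  circleIntegrable_of_continuousOn (hF.norm.pow 2)

theorem meanSq_nonneg (F : ℂ → ℂ) : 0 ≤ meanSq F :=
  circleAverage_nonneg_of_nonneg fun _ _ => by positivity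

theorem circleAverage_le_of_le {u v : ℂ → ℝ} (hu : ContinuousOn u (closedBall 0 1))
    (hv : ContinuousOn v (closedBall 0 1)) (h : ∀ z, ‖z‖ = 1 → u z ≤ v z) :
    circleAverage u 0 1 ≤ circleAverage v 0 1 :=
  circleAverage_mono (circleIntegrable_of_continuousOn hu) (circleIntegrable_of_continuousOn hv)
    fun z hz => h z (by simpa using hz)

theorem meanSq_le_affine {F G : ℂ → ℂ} (hF : ContinuousOn F (closedBall 0 1))
    (hG : ContinuousOn G (closedBall 0 1)) {a b : ℝ}
    (h : ∀ z, ‖z‖ = 1 → ‖F z‖ ^ 2 ≤ a * ‖G z‖ ^ 2 + b) : meanSq F ≤ a * meanSq G + b := by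
  have h1 : meanSq F ≤ circleAverage (fun z => a * ‖G z‖ ^ 2 + b) 0 1 :=
    circleAverage_le_of_le (hF.norm.pow 2)
      ((continuousOn_const.mul (hG.norm.pow 2)).add continuousOn_const) h
  refine h1.trans_eq ?_
  have hc : CircleIntegrable (fun z => a * ‖G z‖ ^ 2) 0 1 :=
    circleIntegrable_of_continuousOn (continuousOn_const.mul (hG.norm.pow 2))
  rw [circleAverage_fun_add hc (circleIntegrable_const _ _ _), circleAverage_const]
  congr 1
  exact circleAverage_fun_smul (a := a) (f := fun z => ‖G z‖ ^ 2)

theorem meanSq_le_of_norm_le {F : ℂ → ℂ} (hF : ContinuousOn F (closedBall 0 1)) {b : ℝ}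
    (h : ∀ z, ‖z‖ = 1 → ‖F z‖ ^ 2 ≤ b) : meanSq F ≤ b := by
  simpa using meanSq_le_affine hF hF (a := 0) (b := b) (by simpa using h)

theorem diffContOnCl_dslope {F : ℂ → ℂ} (hF : DiffContOnCl ℂ F (ball 0 1)) :
    DiffContOnCl ℂ (dslope F 0) (ball 0 1) := by
  refine DiffContOnCl.mk_ball ?_ ?_
  · exact (Complex.differentiableOn_dslope (ball_mem_nhds 0 one_pos)).2 hF.differentiableOn
  · exact (continuousOn_dslope (closedBall_mem_nhds 0 one_pos)).2
      ⟨diffContOnCl_continuousOn hF, hF.differentiableAt' (ball_mem_nhds 0 one_pos)⟩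

theorem eq_add_mul_dslope (F : ℂ → ℂ) (z : ℂ) : F z = F 0 + z * dslope F 0 z := by
  have := sub_smul_dslope F 0 z
  simp only [sub_zero, smul_eq_mul] at this
  rw [this]; ring

/-- The orthogonal decomposition `F = F(0) + z G` in `L²` of the circle. -/
theorem meanSq_eq_add_dslope {F : ℂ → ℂ} (hF : DiffContOnCl ℂ F (ball 0 1)) :
    meanSq F = ‖F 0‖ ^ 2 + meanSq (dslope F 0) := by
  set G := dslope F 0 with hGdef
  have hG := diffContOnCl_dslope hF
  have hGc := diffContOnCl_continuousOn hG
  have hid : DiffContOnCl ℂ (fun z : ℂ => z) (ball 0 1) := differentiable_id.diffContOnCl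
  -- The cross term of the expansion is the real part of this function, which vanishes at `0`; by
  -- the mean value property its average is `0`.
  have hH : DiffContOnCl ℂ (fun z => (2 * star (F 0)) * (z * G z)) (ball 0 1) :=
    (hid.smul hG).const_smul (2 * star (F 0))
  have h1 : meanSq F = circleAverage (fun z => (‖F 0‖ ^ 2 +
      ((2 * star (F 0)) * (z * G z)).re) + ‖G z‖ ^ 2) 0 1 := by
    refine circleAverage_congr_sphere fun z hz => ?_
    have hz1 : ‖z‖ = 1 := by simpa using hz
    have h2 : F z = F 0 + z * G z := eq_add_mul_dslope F z
    have h3 : ‖G z‖ ^ 2 = ‖z * G z‖ ^ 2 := by rw [norm_mul, hz1, one_mul]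
    change ‖F z‖ ^ 2 = _ + ‖G z‖ ^ 2
    rw [h3, h2]
    simp only [← Complex.normSq_eq_norm_sq, Complex.normSq_apply]
    simp
    ring
  have hc : CircleIntegrable (fun z => ((2 * star (F 0)) * (z * G z)).re) 0 1 :=
    circleIntegrable_of_continuousOn
      (Complex.continuous_re.comp_continuousOn (diffContOnCl_continuousOn hH))
  have hc' : CircleIntegrable (fun z => ‖F 0‖ ^ 2 + ((2 * star (F 0)) * (z * G z)).re) 0 1 :=
    (circleIntegrable_const _ _ _).add hc
  rw [h1, circleAverage_fun_add hc' (circleIntegrable_norm_sq hGc),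
    circleAverage_fun_add (circleIntegrable_const _ _ _) hc,
    circleAverage_const, circleAverage_re hH]
  simp [meanSq, hGdef]

theorem norm_sq_zero_le_meanSq {F : ℂ → ℂ} (hF : DiffContOnCl ℂ F (ball 0 1)) :
    ‖F 0‖ ^ 2 ≤ meanSq F := by
  rw [meanSq_eq_add_dslope hF]
  exact le_add_of_nonneg_right (meanSq_nonneg _)

/-- Division by `z ^ m` up to a boundary error that is controlled by the `L²` norm. -/
theorem exists_pow_mul_near {F : ℂ → ℂ} (hF : DiffContOnCl ℂ F (ball 0 1)) {s : ℝ} (hs : 0 ≤ s)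
    (hFs : meanSq F ≤ s ^ 2) (m : ℕ) :
    ∃ G : ℂ → ℂ, DiffContOnCl ℂ G (ball 0 1) ∧ meanSq G ≤ s ^ 2 ∧
      ∀ z, ‖z‖ = 1 → ‖z ^ m * G z - F z‖ ≤ m * s := by
  induction m with
  | zero => exact ⟨F, hF, hFs, by simp⟩
  | succ m ih =>
    obtain ⟨G, hG, hGs, hGF⟩ := ih
    -- Dividing by `z` once more discards the constant `G 0`, which costs at most the `L²` norm on
    -- the circle and does not increase that norm.
    refine ⟨dslope G 0, diffContOnCl_dslope hG, ?_, fun z hz => ?_⟩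
    · have := meanSq_eq_add_dslope hG
      nlinarith [sq_nonneg ‖G 0‖]
    · have h0 : ‖G 0‖ ≤ s := by
        have := (norm_sq_zero_le_meanSq hG).trans hGs
        exact (sq_le_sq₀ (norm_nonneg _) hs).1 this
      have h1 : z ^ (m + 1) * dslope G 0 z - F z = (z ^ m * G z - F z) - z ^ m * G 0 := by
        rw [eq_add_mul_dslope G z]; ring
      rw [h1]
      refine (norm_sub_le _ _).trans ?_
      rw [norm_mul, norm_pow, hz, one_pow, one_mul]
      push_cast
      linarith [hGF z hz]

/-! ### Functions of the disc algebra as elements of `H²` -/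

/-- The restriction to the open disc of a function on the plane. -/
def restrictDisc (F : ℂ → ℂ) : 𝔻 → ℂ := fun z => F z

/-- Bessel's inequality: the iterated slopes at `0` are the Taylor coefficients. The induction
carries the exact identity, with the mean square of the remainder, and drops the remainder at the
end. This is what bounds `H²` norms by circle averages. -/
theorem sum_dslope_le_meanSq {F : ℂ → ℂ} (hF : DiffContOnCl ℂ F (ball 0 1)) (n : ℕ) :
    ∑ k ∈ Finset.range n, ‖((Function.swap dslope (0 : ℂ))^[k] F) 0‖ ^ 2 ≤ meanSq F := by
  suffices h : DiffContOnCl ℂ ((Function.swap dslope (0 : ℂ))^[n] F) (ball 0 1) ∧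
      ∑ k ∈ Finset.range n, ‖((Function.swap dslope (0 : ℂ))^[k] F) 0‖ ^ 2 +
        meanSq ((Function.swap dslope (0 : ℂ))^[n] F) = meanSq F by
    linarith [h.2, meanSq_nonneg ((Function.swap dslope (0 : ℂ))^[n] F)]
  induction n with
  | zero => simpa using hF
  | succ n ih =>
    rw [Function.iterate_succ_apply', Finset.sum_range_succ]
    refine ⟨diffContOnCl_dslope ih.1, ?_⟩
    rw [← ih.2, meanSq_eq_add_dslope ih.1]
    simp only [Function.swap]
    ring

theorem exists_hasSum_coeff {F : ℂ → ℂ} (hF : DiffContOnCl ℂ F (ball 0 1)) :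
    ∃ a : ℕ → ℂ, (∀ z : 𝔻, HasSum (fun k => a k * (z : ℂ) ^ k) (restrictDisc F z)) ∧
      ∀ n, ∑ k ∈ Finset.range n, ‖a k‖ ^ 2 ≤ meanSq F := by
  have hp := DiffContOnCl.hasFPowerSeriesOnBall (R := 1) (by simpa using hF) one_pos
  set p := cauchyPowerSeries F 0 (1 : NNReal)
  refine ⟨p.coeff, fun z => ?_, fun n => ?_⟩
  · have hz : (z : ℂ) ∈ eball (0 : ℂ) ((1 : NNReal) : ENNReal) := by
      rw [mem_eball, edist_zero_right]
      have := z.norm_lt_one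
      rw [enorm_eq_nnnorm]
      exact_mod_cast this
    have := hp.hasSum hz
    simpa [restrictDisc, FormalMultilinearSeries.apply_eq_pow_smul_coeff, mul_comm] using this
  · refine le_of_eq_of_le ?_ (sum_dslope_le_meanSq hF n)
    refine Finset.sum_congr rfl fun k _ => ?_
    have h1 := HasFPowerSeriesAt.has_fpower_series_iterate_dslope_fslope k hp.hasFPowerSeriesAt
    rw [← h1.coeff_zero 1, ← FormalMultilinearSeries.coeff,
      FormalMultilinearSeries.coeff_iterate_fslope, zero_add]

theorem isHardy_restrictDisc {F : ℂ → ℂ} (hF : DiffContOnCl ℂ F (ball 0 1)) :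
    IsHardy (restrictDisc F) := by
  obtain ⟨a, h1, h2⟩ := exists_hasSum_coeff hF
  exact isHardy_of_hasSum (summable_of_sum_range_le (fun _ => by positivity) h2) h1

/-- A function of the disc algebra as an element of `H²`. -/
def ofDisc (F : ℂ → ℂ) (hF : DiffContOnCl ℂ F (ball 0 1)) : H2 :=
  H2.mk (restrictDisc F) (isHardy_restrictDisc hF)

theorem fn_ofDisc (F : ℂ → ℂ) (hF : DiffContOnCl ℂ F (ball 0 1)) (z : 𝔻) :
    (ofDisc F hF).fn z = F z := rfl

theorem norm_sq_ofDisc_le {F : ℂ → ℂ} (hF : DiffContOnCl ℂ F (ball 0 1)) :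
    ‖ofDisc F hF‖ ^ 2 ≤ meanSq F := by
  obtain ⟨a, h1, h2⟩ := exists_hasSum_coeff hF
  rw [H2.norm_sq_eq]
  have h3 : taylorCoeff (ofDisc F hF).fn = a := (of_hasSum h1).2
  rw [h3]
  exact Real.tsum_le_of_sum_range_le (fun _ => by positivity) h2

/-! ### Approximation on compact null sets of the circle -/

/-- A compact subset of the unit circle, seen in the plane, of arc length zero. -/
structure IsNullCompact (K : Set ℂ) : Prop where
  isCompact : IsCompact K
  norm_eq_one : ∀ z ∈ K, ‖z‖ = 1
  null : MeasureTheory.volume {t : ℝ | t ∈ Set.Ico 0 (2 * π) ∧ circleMap 0 1 t ∈ K} = 0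

/-- Laurent polynomials are dense in the continuous functions on a compact subset of the
circle. -/
theorem exists_laurent_near {K : Set ℂ} (hK : IsCompact K) (hK1 : ∀ z ∈ K, ‖z‖ = 1)
    {v : ℂ → ℂ} (hv : ContinuousOn v K) {ε : ℝ} (hε : 0 < ε) :
    ∃ (m : ℕ) (q : Polynomial ℂ), ∀ z ∈ K, ‖z ^ m * v z - q.eval z‖ < ε := by
  have : CompactSpace K := isCompact_iff_compactSpace.1 hK
  -- On the circle `conj z = 1 / z`, so every polynomial in `z` and `conj z` becomes a polynomial in
  -- `z` after multiplication by a power of `z`. Stone–Weierstrass then gives density.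
  have hlaurent : ∀ f ∈ (polynomialFunctions K).starClosure,
      ∃ (m : ℕ) (q : Polynomial ℂ), ∀ z : K, (z : ℂ) ^ m * f z = q.eval (z : ℂ) := by
    intro f hf
    rw [polynomialFunctions.starClosure_eq_adjoin_X] at hf
    induction hf using Algebra.adjoin_induction with
    | mem f hf =>
      push _ ∈ _ at hf
      rw [star_eq_iff_star_eq, eq_comm (b := f)] at hf
      obtain (rfl | rfl) := hf
      · exact ⟨0, Polynomial.X, fun z => by simp⟩
      · refine ⟨1, 1, fun z => ?_⟩
        simp [Complex.mul_conj', hK1 z z.2]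
    | algebraMap r => exact ⟨0, Polynomial.C r, fun z => by simp [Algebra.algebraMap_eq_smul_one]⟩
    | add f g _ _ hf hg =>
      obtain ⟨m, q, h⟩ := hf
      obtain ⟨n, r, h'⟩ := hg
      refine ⟨m + n, Polynomial.X ^ n * q + Polynomial.X ^ m * r, fun z => ?_⟩
      simp [← h, ← h']
      ring
    | mul f g _ _ hf hg =>
      obtain ⟨m, q, h⟩ := hf
      obtain ⟨n, r, h'⟩ := hg
      refine ⟨m + n, q * r, fun z => ?_⟩
      simp [← h, ← h']
      ring
  have hdense : (⟨K.domRestrict v, hv.domRestrict⟩ : C(K, ℂ)) ∈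
      closure ((polynomialFunctions K).starClosure : Set C(K, ℂ)) := by
    rw [← StarSubalgebra.topologicalClosure_coe,
      polynomialFunctions.starClosure_topologicalClosure K]
    trivial
  obtain ⟨f, hf, hfd⟩ := Metric.mem_closure_iff.1 hdense ε hε
  obtain ⟨m, q, h⟩ := hlaurent f hf
  refine ⟨m, q, fun z hz => ?_⟩
  rw [← h ⟨z, hz⟩, ← mul_sub, norm_mul, norm_pow, hK1 z hz, one_pow, one_mul, ← dist_eq_norm]
  exact (ContinuousMap.dist_apply_le_dist (⟨z, hz⟩ : K)).trans_lt hfd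

theorem conj_mul_self_of_norm_eq_one {z : ℂ} (hz : ‖z‖ = 1) : (starRingEnd ℂ) z * z = 1 := by
  rw [Complex.conj_mul', hz]; simp

/-- A monomial of negative degree on the circle is the conjugate of one of positive degree, and
conjugation does not change real parts. -/
theorem exists_re_eq_re_laurent (m : ℕ) (q : Polynomial ℂ) :
    ∃ h : Polynomial ℂ, ∀ z : ℂ, ‖z‖ = 1 →
      (h.eval z).re = ((starRingEnd ℂ) z ^ m * q.eval z).re := by
  induction q using Polynomial.induction_on' with
  | add p q hp hq =>
    obtain ⟨h, hh⟩ := hp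
    obtain ⟨k, hk⟩ := hq
    exact ⟨h + k, fun z hz => by simp [mul_add, hh z hz, hk z hz]⟩
  | monomial n c =>
    rcases le_total m n with hmn | hmn
    · obtain ⟨j, rfl⟩ := Nat.exists_eq_add_of_le hmn
      refine ⟨Polynomial.monomial j c, fun z hz => congrArg Complex.re ?_⟩
      simp only [Polynomial.eval_monomial]
      calc c * z ^ j = ((starRingEnd ℂ) z * z) ^ m * (c * z ^ j) := by
            rw [conj_mul_self_of_norm_eq_one hz]; simp
        _ = _ := by ring
    · obtain ⟨j, rfl⟩ := Nat.exists_eq_add_of_le hmn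
      refine ⟨Polynomial.monomial j ((starRingEnd ℂ) c), fun z hz => ?_⟩
      simp only [Polynomial.eval_monomial]
      rw [← Complex.conj_re]
      refine congrArg Complex.re ?_
      calc (starRingEnd ℂ) ((starRingEnd ℂ) c * z ^ j)
          = ((starRingEnd ℂ) z * z) ^ n * (c * (starRingEnd ℂ) z ^ j) := by
            rw [conj_mul_self_of_norm_eq_one hz]; simp
        _ = _ := by ring

/-- Real parts of polynomials are dense in the real continuous functions on the circle. -/
theorem exists_re_near {ρ : ℂ → ℝ} (hρ : Continuous ρ) {ε : ℝ} (hε : 0 < ε) :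
    ∃ h : Polynomial ℂ, ∀ z : ℂ, ‖z‖ = 1 → |(h.eval z).re - ρ z| < ε := by
  obtain ⟨m, q, hq⟩ := exists_laurent_near (isCompact_sphere (0 : ℂ) 1)
    (fun z hz => by simpa using hz) (v := fun z => (ρ z : ℂ)) (by fun_prop) hε
  obtain ⟨h, hh⟩ := exists_re_eq_re_laurent m q
  refine ⟨h, fun z hz => ?_⟩
  have h1 : (h.eval z).re - ρ z =
      ((starRingEnd ℂ) z ^ m * (q.eval z - z ^ m * (ρ z : ℂ))).re := by
    have : (starRingEnd ℂ) z ^ m * (q.eval z - z ^ m * (ρ z : ℂ)) =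
        (starRingEnd ℂ) z ^ m * q.eval z - ((starRingEnd ℂ) z * z) ^ m * (ρ z : ℂ) := by ring
    rw [this, conj_mul_self_of_norm_eq_one hz, hh z hz]
    simp
  rw [h1]
  refine (Complex.abs_re_le_norm _).trans_lt ?_
  rw [norm_mul, norm_pow, RCLike.norm_conj, hz, one_pow, one_mul, norm_sub_rev]
  exact hq z (by simpa using hz)

/-- A continuous function that is large on a null set and small on average. -/
theorem IsNullCompact.exists_bump {K : Set ℂ} (hK : IsNullCompact K) {R η : ℝ} (hR : 0 < R)
    (hη : 0 < η) : ∃ ρ : ℂ → ℝ, Continuous ρ ∧ (∀ z, 0 ≤ ρ z) ∧ (∀ z ∈ K, ρ z = R) ∧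
      circleAverage ρ 0 1 < η := by
  -- The distance to the empty set is `0` by convention, so the tent functions below would not decay
  -- in that case.
  rcases K.eq_empty_or_nonempty with rfl | hne
  · exact ⟨0, continuous_const, fun _ => le_rfl, by simp, by simpa [circleAverage_def] using hη⟩
  set ρ : ℕ → ℂ → ℝ := fun j z => R * max 0 (1 - j * infDist z K) with hρ
  have hcont : ∀ j, Continuous (ρ j) := fun j => by
    have := continuous_infDist_pt K
    fun_prop
  have hnonneg : ∀ j z, 0 ≤ ρ j z := fun j z => by positivity
  have hle : ∀ j z, ρ j z ≤ R := fun j z => by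
    have h1 : max 0 (1 - j * infDist z K) ≤ 1 :=
      max_le zero_le_one (sub_le_self 1 (mul_nonneg (Nat.cast_nonneg j) infDist_nonneg))
    simpa [hρ] using mul_le_mul_of_nonneg_left h1 hR.le
  -- The tents are eventually `0` at each point off `K`, hence almost everywhere, and are bounded by
  -- `R`.
  have hlim : Tendsto (fun j => ∫ t in (0 : ℝ)..2 * π, ρ j (circleMap 0 1 t)) atTop
      (𝓝 (∫ t in (0 : ℝ)..2 * π, (0 : ℝ))) := by
    refine intervalIntegral.tendsto_integral_filter_of_dominated_convergence (fun _ => R)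
      (Eventually.of_forall fun j => ?_) (Eventually.of_forall fun j => ?_)
      intervalIntegrable_const ?_
    · exact ((hcont j).comp (continuous_circleMap 0 1)).aestronglyMeasurable
    · exact Eventually.of_forall fun t _ => by
        rw [Real.norm_eq_abs, abs_of_nonneg (hnonneg _ _)]
        exact hle _ _
    · have h2 : ∀ᵐ t : ℝ, t ≠ 2 * π := by simp [MeasureTheory.ae_iff]
      have h3 : ∀ᵐ t : ℝ, ¬ (t ∈ Set.Ico 0 (2 * π) ∧ circleMap 0 1 t ∈ K) := by
        rw [MeasureTheory.ae_iff]
        simpa only [not_not] using hK.null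
      filter_upwards [h2, h3] with t ht2 ht3 ht
      rw [Set.uIoc_of_le two_pi_pos.le] at ht
      have hnot : circleMap 0 1 t ∉ K := fun hmem =>
        ht3 ⟨⟨ht.1.le, lt_of_le_of_ne ht.2 ht2⟩, hmem⟩
      have hpos : 0 < infDist (circleMap 0 1 t) K :=
        (hK.isCompact.isClosed.notMem_iff_infDist_pos hne).1 hnot
      refine tendsto_const_nhds.congr' ?_
      obtain ⟨N, hN⟩ := exists_nat_gt (1 / infDist (circleMap 0 1 t) K)
      filter_upwards [eventually_ge_atTop N] with j hj
      have h4 : 1 ≤ j * infDist (circleMap 0 1 t) K := by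
        rw [div_lt_iff₀ hpos] at hN
        have : (N : ℝ) ≤ j := by exact_mod_cast hj
        nlinarith
      simp only [hρ]
      rw [max_eq_left (by linarith), mul_zero]
  rw [intervalIntegral.integral_zero] at hlim
  obtain ⟨j, hj⟩ := (hlim.eventually (gt_mem_nhds (show 0 < 2 * π * η by positivity))).exists
  refine ⟨ρ j, hcont j, hnonneg j, fun z hz => ?_, ?_⟩
  · simp [hρ, infDist_zero_of_mem hz]
  · rw [circleAverage_def, smul_eq_mul, inv_mul_lt_iff₀ two_pi_pos]
    exact hj

/-- The maximum principle for `exp (-h)`, whose modulus is `exp (-Re h)`. -/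
theorem re_nonneg_of_circle {h : Polynomial ℂ} (hh : ∀ z : ℂ, ‖z‖ = 1 → 0 ≤ (h.eval z).re)
    {z : ℂ} (hz : z ∈ closedBall (0 : ℂ) 1) : 0 ≤ (h.eval z).re := by
  have hd : DiffContOnCl ℂ (fun z => Complex.exp (-h.eval z)) (ball 0 1) :=
    Differentiable.diffContOnCl (by fun_prop)
  have := Complex.norm_le_of_forall_mem_frontier_norm_le isBounded_ball hd (C := 1) (z := z)
    (fun w hw => ?_) (by rwa [closure_ball (0 : ℂ) one_ne_zero])
  · simpa [Complex.norm_exp] using this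
  · rw [frontier_ball (0 : ℂ) one_ne_zero] at hw
    simpa [Complex.norm_exp] using hh w (by simpa using hw)

/-- Functions of the disc algebra that are bounded by one, small in `L²` and close to one on a
null set. -/
theorem IsNullCompact.exists_peak {K : Set ℂ} (hK : IsNullCompact K) {δ : ℝ} (hδ : 0 < δ) :
    ∃ φ : ℂ → ℂ, DiffContOnCl ℂ φ (ball 0 1) ∧ (∀ z, ‖z‖ = 1 → ‖φ z‖ ≤ 1) ∧
      (∀ z ∈ K, ‖φ z - 1‖ ≤ δ) ∧ meanSq φ ≤ δ := by
  obtain ⟨ρ, hρc, hρ0, hρK, hρm⟩ := hK.exists_bump (R := 1 / δ) (η := δ / 4) (by positivity)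
    (by positivity)
  obtain ⟨h₀, hh₀⟩ := exists_re_near hρc (ε := δ / 4) (by positivity)
  -- The shift by `δ / 4` absorbs the approximation error, so that `Re h ≥ ρ` on the circle; the
  -- imaginary constant makes `h 0` real.
  set h : Polynomial ℂ := h₀ + Polynomial.C (((δ / 4 : ℝ) : ℂ) - (h₀.eval 0).im * Complex.I)
    with hhdef
  have hre : ∀ z, (h.eval z).re = (h₀.eval z).re + δ / 4 := fun z => by simp [hhdef]
  have hge : ∀ z : ℂ, ‖z‖ = 1 → ρ z ≤ (h.eval z).re := fun z hz => by
    rw [hre]; linarith [(abs_lt.1 (hh₀ z hz)).1]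
  have hnn : ∀ z ∈ closedBall (0 : ℂ) 1, 0 ≤ (h.eval z).re := fun z hz =>
    re_nonneg_of_circle (fun w hw => (hρ0 w).trans (hge w hw)) hz
  have hne : ∀ z ∈ closedBall (0 : ℂ) 1, 1 + h.eval z ≠ 0 := fun z hz h0 => by
    have := congrArg Complex.re h0
    simp at this
    linarith [hnn z hz]
  have hdp : ∀ p : Polynomial ℂ, DiffContOnCl ℂ (fun z => p.eval z) (ball 0 1) := fun p =>
    p.differentiable.diffContOnCl
  have hdinv : DiffContOnCl ℂ (fun z => (1 + h.eval z)⁻¹) (ball 0 1) :=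
    ((hdp h).const_add 1).inv (by rwa [closure_ball (0 : ℂ) one_ne_zero])
  have hd : DiffContOnCl ℂ (fun z => h.eval z * (1 + h.eval z)⁻¹) (ball 0 1) :=
    (hdp h).smul hdinv
  have hc := diffContOnCl_continuousOn hd
  -- For `φ = h / (1 + h)` and `Re h ≥ 0` one has `|φ|² ≤ Re φ`. This gives `|φ| ≤ 1`, and also
  -- `meanSq φ ≤ Re φ 0` by the mean value property.
  have hsq : ∀ z : ℂ, ‖z‖ = 1 → ‖h.eval z * (1 + h.eval z)⁻¹‖ ^ 2 ≤
      (h.eval z * (1 + h.eval z)⁻¹).re := by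
    intro z hz
    have hz1 : z ∈ closedBall (0 : ℂ) 1 := by simp [hz]
    have h0 := hnn z hz1
    have h1 : 0 < Complex.normSq (1 + h.eval z) := Complex.normSq_pos.2 (hne z hz1)
    rw [← Complex.normSq_eq_norm_sq, ← div_eq_mul_inv, map_div₀, Complex.div_re, ← add_div]
    refine div_le_div_of_nonneg_right ?_ h1.le
    simp [Complex.normSq_apply]
    nlinarith
  refine ⟨fun z => h.eval z * (1 + h.eval z)⁻¹, hd, fun z hz => ?_, fun z hz => ?_, ?_⟩
  · have h1 := hsq z hz
    have h2 := Complex.re_le_norm (h.eval z * (1 + h.eval z)⁻¹)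
    by_contra! h3
    nlinarith
  · have hz1 := hK.norm_eq_one z hz
    have hz2 : z ∈ closedBall (0 : ℂ) 1 := by simp [hz1]
    have h1 : h.eval z * (1 + h.eval z)⁻¹ - 1 = -(1 + h.eval z)⁻¹ := by
      have := hne z hz2
      field_simp
      ring
    have h2 : 1 / δ ≤ ‖1 + h.eval z‖ := by
      refine le_trans ?_ (Complex.re_le_norm _)
      have := hge z hz1
      rw [hρK z hz] at this
      simpa using this.trans (by linarith)
    rw [h1, norm_neg, norm_inv]
    exact inv_le_of_inv_le₀ hδ (by simpa using h2)
  · have h1 : meanSq (fun z => h.eval z * (1 + h.eval z)⁻¹) ≤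
        circleAverage (fun z => (h.eval z * (1 + h.eval z)⁻¹).re) 0 1 :=
      circleAverage_le_of_le (hc.norm.pow 2) (Complex.continuous_re.comp_continuousOn hc) hsq
    have h2 : (h₀.eval 0).re ≤ δ / 2 := by
      have h3 : circleAverage (fun z => (h₀.eval z).re) 0 1 ≤
          circleAverage (fun z => ρ z + δ / 4) 0 1 :=
        circleAverage_le_of_le (Complex.continuous_re.comp_continuousOn
          (diffContOnCl_continuousOn (hdp h₀))) (hρc.continuousOn.add continuousOn_const)
          fun z hz => by linarith [(abs_lt.1 (hh₀ z hz)).2]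
      rw [circleAverage_re (hdp h₀), circleAverage_fun_add
        (circleIntegrable_of_continuousOn hρc.continuousOn) (circleIntegrable_const _ _ _),
        circleAverage_const] at h3
      linarith
    rw [circleAverage_re hd] at h1
    refine h1.trans ?_
    have h3 : h.eval 0 = (((h₀.eval 0).re + δ / 4 : ℝ) : ℂ) := by
      apply Complex.ext <;> simp [hhdef]
    have h4 := hnn 0 (by simp)
    rw [h3] at h4 ⊢
    rw [Complex.ofReal_re] at h4
    set a := (h₀.eval 0).re + δ / 4
    have h5 : (a : ℂ) * (1 + (a : ℂ))⁻¹ = ((a * (1 + a)⁻¹ : ℝ) : ℂ) := by push_cast; rfl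
    rw [h5, Complex.ofReal_re]
    have h6 : (1 + a)⁻¹ ≤ 1 := inv_le_one_of_one_le₀ (by linarith)
    have h7 : a ≤ δ := by simp only [a]; linarith
    exact (mul_le_of_le_one_right h4 h6).trans h7

theorem exists_bound_closedBall {F : ℂ → ℂ} (hF : ContinuousOn F (closedBall 0 1)) :
    ∃ A : ℝ, 0 < A ∧ ∀ z ∈ closedBall (0 : ℂ) 1, ‖F z‖ ≤ A := by
  obtain ⟨A, hA⟩ := (isCompact_closedBall (0 : ℂ) 1).exists_bound_of_continuousOn hF
  exact ⟨max A 1, by positivity, fun z hz => (hA z hz).trans (le_max_left _ _)⟩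

/-- Simultaneous approximation of `v` on a null set and of `0` in `L²`, with a uniform bound on
the circle. -/
theorem IsNullCompact.exists_near_and_small {K : Set ℂ} (hK : IsNullCompact K) {v : ℂ → ℂ}
    (hv : ContinuousOn v K) {ε : ℝ} (hε : 0 < ε) :
    ∃ M : ℝ, ∀ δ > 0, ∃ d : ℂ → ℂ, DiffContOnCl ℂ d (ball 0 1) ∧
      (∀ z ∈ K, ‖d z - v z‖ ≤ ε) ∧ (∀ z, ‖z‖ = 1 → ‖d z‖ ≤ M) ∧ meanSq d ≤ δ := by
  obtain ⟨m, q, hq⟩ := exists_laurent_near hK.isCompact hK.norm_eq_one hv (half_pos hε)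
  obtain ⟨A, hA0, hA⟩ := exists_bound_closedBall (F := fun z => q.eval z) q.continuousOn
  -- The bound is independent of `δ`: `A` bounds `q φ`, and the division by `z ^ m` costs at most `m
  -- * s ≤ m`.
  refine ⟨A + m, fun δ hδ => ?_⟩
  obtain ⟨s, hs0, hs1, hs2, hs3⟩ : ∃ s : ℝ, 0 < s ∧ s ≤ 1 ∧ s ^ 2 ≤ δ ∧ m * s ≤ ε / 4 := by
    have hm : (0 : ℝ) < m + 1 := by positivity
    refine ⟨min 1 (min (√δ) (ε / (4 * (m + 1)))), by positivity, min_le_left _ _, ?_, ?_⟩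
    · calc _ ≤ √δ ^ 2 := by
            gcongr
            exact (min_le_right _ _).trans (min_le_left _ _)
        _ = δ := sq_sqrt hδ.le
    · calc _ ≤ (m + 1) * (ε / (4 * (m + 1))) := by
            gcongr
            · linarith
            · exact (min_le_right _ _).trans (min_le_right _ _)
        _ = ε / 4 := by field_simp
  obtain ⟨τ, hτ0, hτ1, hτ2⟩ : ∃ τ : ℝ, 0 < τ ∧ A ^ 2 * τ ≤ s ^ 2 ∧ A * τ ≤ ε / 4 := by
    refine ⟨min (s ^ 2 / A ^ 2) (ε / (4 * A)), by positivity, ?_, ?_⟩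
    · calc _ ≤ A ^ 2 * (s ^ 2 / A ^ 2) := by gcongr; exact min_le_left _ _
        _ = s ^ 2 := by field_simp
    · calc _ ≤ A * (ε / (4 * A)) := by gcongr; exact min_le_right _ _
        _ = ε / 4 := by field_simp
  obtain ⟨φ, hφ, hφ1, hφK, hφm⟩ := hK.exists_peak hτ0
  have hF : DiffContOnCl ℂ (fun z => q.eval z * φ z) (ball 0 1) :=
    DiffContOnCl.smul q.differentiable.diffContOnCl hφ
  have hmem : ∀ z : ℂ, ‖z‖ = 1 → z ∈ closedBall (0 : ℂ) 1 := fun z hz => by simp [hz]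
  have hFm : meanSq (fun z => q.eval z * φ z) ≤ s ^ 2 := by
    refine (meanSq_le_affine (diffContOnCl_continuousOn hF) (diffContOnCl_continuousOn hφ)
      (a := A ^ 2) (b := 0) fun z hz => ?_).trans ?_
    · rw [norm_mul, mul_pow, add_zero]
      gcongr
      exact hA z (hmem z hz)
    · rw [add_zero]
      exact (mul_le_mul_of_nonneg_left hφm (by positivity)).trans hτ1
  obtain ⟨G, hG, hGs, hGF⟩ := exists_pow_mul_near hF hs0.le hFm m
  refine ⟨G, hG, fun z hz => ?_, fun z hz => ?_, hGs.trans hs2⟩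
  · have hz1 := hK.norm_eq_one z hz
    have h1 : ‖G z - v z‖ = ‖z ^ m * (G z - v z)‖ := by
      rw [norm_mul, norm_pow, hz1, one_pow, one_mul]
    -- The three errors come from the division by `z ^ m`, from the peak function and from the
    -- Laurent approximation: `ε / 4 + ε / 4 + ε / 2`.
    have h2 : z ^ m * (G z - v z) = (z ^ m * G z - q.eval z * φ z) + q.eval z * (φ z - 1) -
        (z ^ m * v z - q.eval z) := by ring
    rw [h1, h2]
    refine (norm_sub_le _ _).trans ((add_le_add_left (norm_add_le _ _) _).trans ?_)
    have h3 : ‖q.eval z * (φ z - 1)‖ ≤ A * τ := by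
      rw [norm_mul]
      exact mul_le_mul (hA z (hmem z hz1)) (hφK z hz) (norm_nonneg _) hA0.le
    linarith [hGF z hz1, hq z hz]
  · have h1 : ‖G z‖ = ‖z ^ m * G z‖ := by rw [norm_mul, norm_pow, hz, one_pow, one_mul]
    have h2 : z ^ m * G z = (z ^ m * G z - q.eval z * φ z) + q.eval z * φ z := by ring
    rw [h1, h2]
    refine (norm_add_le _ _).trans ?_
    have h3 : ‖q.eval z * φ z‖ ≤ A * 1 := by
      rw [norm_mul]
      exact mul_le_mul (hA z (hmem z hz)) (hφ1 z hz) (norm_nonneg _) hA0.le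
    have h4 : m * s ≤ m * 1 := by gcongr
    linarith [hGF z hz]

/-! ### Zero-free approximation by exponentials -/

theorem exists_circleMap_eq {z : ℂ} (hz : ‖z‖ = 1) :
    ∃ t ∈ Set.Ico 0 (2 * π), circleMap 0 1 t = z := by
  have h1 : z ∈ Set.range (circleMap 0 1) := by simpa [range_circleMap] using hz
  obtain ⟨t, rfl⟩ := h1
  obtain ⟨s, hs, h2⟩ := (periodic_circleMap 0 1).exists_mem_Ico₀ two_pi_pos t
  exact ⟨s, hs, h2.symm⟩

/-- On a null set every continuous function is a limit of exponentials. -/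
theorem IsNullCompact.exists_exp_near {K : Set ℂ} (hK : IsNullCompact K) {G : ℂ → ℂ}
    (hG : ContinuousOn G K) {ε : ℝ} (hε : 0 < ε) :
    ∃ v : ℂ → ℂ, ContinuousOn v K ∧ ∀ z ∈ K, ‖Complex.exp (v z) - G z‖ < ε := by
  obtain ⟨m, q, hq⟩ := exists_laurent_near hK.isCompact hK.norm_eq_one hG (half_pos hε)
  set L : ℂ → ℂ := fun z => (starRingEnd ℂ) z ^ m * q.eval z with hL
  have hLG : ∀ z ∈ K, ‖L z - G z‖ < ε / 2 := by
    intro z hz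
    have hz1 := hK.norm_eq_one z hz
    have h1 : L z - G z = (starRingEnd ℂ) z ^ m * (q.eval z - z ^ m * G z) := by
      have : (starRingEnd ℂ) z ^ m * (q.eval z - z ^ m * G z) =
        (starRingEnd ℂ) z ^ m * q.eval z - ((starRingEnd ℂ) z * z) ^ m * G z := by ring
      rw [this, conj_mul_self_of_norm_eq_one hz1, one_pow, one_mul]
    rw [h1, norm_mul, norm_pow, RCLike.norm_conj, hz1, one_pow, one_mul, norm_sub_rev]
    exact hq z hz
  set u : ℝ → ℝ := fun t => (L (circleMap 0 1 t)).im with hu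
  have hud : Differentiable ℝ u := by
    have h1 : Differentiable ℝ (fun t : ℝ => circleMap 0 1 t) := differentiable_circleMap 0 1
    have h2 : Differentiable ℝ (fun t : ℝ => (starRingEnd ℂ) (circleMap 0 1 t)) :=
      Complex.conjCLE.differentiable.comp h1
    have h3 : Differentiable ℝ (fun t : ℝ => q.eval (circleMap 0 1 t)) :=
      (q.differentiable.restrictScalars ℝ).comp h1
    exact Complex.imCLM.differentiable.comp ((h2.pow m).mul h3)
  -- The imaginary part of the Laurent polynomial takes only a null set of values on `K`, so a small
  -- shift `y` moves all its values on `K` off the real axis, into the domain of the principal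
  -- logarithm.
  have hnull := MeasureTheory.addHaar_image_eq_zero_of_differentiableOn_of_addHaar_eq_zero
    MeasureTheory.volume hud.differentiableOn hK.null
  obtain ⟨y, hy, hyn⟩ : ∃ y ∈ Set.Ioo 0 (ε / 2),
      y ∉ u '' {t : ℝ | t ∈ Set.Ico 0 (2 * π) ∧ circleMap 0 1 t ∈ K} := by
    by_contra! hcon
    have h1 := (MeasureTheory.measure_mono (μ := MeasureTheory.volume) hcon).trans hnull.le
    rw [Real.volume_Ioo] at h1
    simp at h1
    linarith
  have him : ∀ z ∈ K, (L z - y * Complex.I).im ≠ 0 := by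
    intro z hz h0
    obtain ⟨t, ht, rfl⟩ := exists_circleMap_eq (hK.norm_eq_one z hz)
    refine hyn ⟨t, ⟨ht, hz⟩, ?_⟩
    simp at h0
    simp only [hu]
    linarith
  have hcont : ContinuousOn (fun z => L z - y * Complex.I) K := by
    have : Continuous fun z => L z - y * Complex.I := by
      simp only [hL]
      have := q.continuous
      fun_prop
    exact this.continuousOn
  refine ⟨fun z => Complex.log (L z - y * Complex.I), hcont.clog fun z hz => ?_, fun z hz => ?_⟩
  · exact Complex.mem_slitPlane_iff.2 (Or.inr (him z hz))
  · have hne : L z - y * Complex.I ≠ 0 := fun h0 => him z hz (by rw [h0]; rfl)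
    rw [Complex.exp_log hne]
    have h1 : L z - y * Complex.I - G z = (L z - G z) - y * Complex.I := by ring
    rw [h1]
    refine (norm_sub_le _ _).trans_lt ?_
    have h2 : ‖(y : ℂ) * Complex.I‖ = y := by
      rw [norm_mul, Complex.norm_I, mul_one, Complex.norm_real, Real.norm_eq_abs,
        abs_of_pos hy.1]
    rw [h2]
    linarith [hLG z hz, hy.2]

/-- Functions of the disc algebra are uniform limits of polynomials. -/
theorem exists_polynomial_near {F : ℂ → ℂ} (hF : DiffContOnCl ℂ F (ball 0 1)) {ε : ℝ}
    (hε : 0 < ε) : ∃ P : Polynomial ℂ, ∀ z ∈ closedBall (0 : ℂ) 1, ‖P.eval z - F z‖ < ε := by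
  have huc := (isCompact_closedBall (0 : ℂ) 1).uniformContinuousOn_of_continuous
    (diffContOnCl_continuousOn hF)
  obtain ⟨δ, hδ, hd⟩ := Metric.uniformContinuousOn_iff.1 huc (ε / 2) (half_pos hε)
  -- The dilation `F (r z)` is uniformly close to `F`, and the Taylor sums of `F` converge uniformly
  -- on a disc of radius `r'` with `r < r' < 1`.
  obtain ⟨r, hr0, hr1, hrδ⟩ : ∃ r : ℝ, 0 < r ∧ r < 1 ∧ 1 - r < δ := by
    refine ⟨1 - min δ 1 / 2, ?_, ?_, ?_⟩
    · linarith [min_le_right δ 1]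
    · linarith [lt_min hδ one_pos]
    · linarith [min_le_left δ 1, lt_min hδ one_pos]
  have hp := DiffContOnCl.hasFPowerSeriesOnBall (R := 1) (by simpa using hF) one_pos
  obtain ⟨r', hrr', hr'1⟩ := exists_between hr1
  lift r' to NNReal using (hr0.trans hrr').le
  have hunif := hp.tendstoUniformlyOn' (r' := r') (by exact_mod_cast hr'1)
  obtain ⟨n, hn⟩ := (Metric.tendstoUniformlyOn_iff.1 hunif (ε / 2) (half_pos hε)).exists
  set p := cauchyPowerSeries F 0 (1 : NNReal)
  refine ⟨∑ k ∈ Finset.range n, Polynomial.monomial k (p.coeff k * (r : ℂ) ^ k), fun z hz => ?_⟩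
  have hz1 : ‖z‖ ≤ 1 := by simpa using hz
  have hrz : ‖(r : ℂ) * z‖ ≤ r := by
    rw [norm_mul, Complex.norm_real, Real.norm_eq_abs, abs_of_pos hr0]
    exact mul_le_of_le_one_right hr0.le hz1
  have h1 : Polynomial.eval z
      (∑ k ∈ Finset.range n, Polynomial.monomial k (p.coeff k * (r : ℂ) ^ k)) =
      p.partialSum n (r * z - 0) := by
    rw [Polynomial.eval_finsetSum, FormalMultilinearSeries.partialSum, sub_zero]
    refine Finset.sum_congr rfl fun k _ => ?_
    rw [Polynomial.eval_monomial, FormalMultilinearSeries.apply_eq_pow_smul_coeff, smul_eq_mul]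
    ring
  have h2 := hn (r * z) (by simpa using hrz.trans_lt hrr')
  have h3 : dist ((r : ℂ) * z) z < δ := by
    have : (r : ℂ) * z - z = ((r - 1 : ℝ) : ℂ) * z := by push_cast; ring
    rw [dist_eq_norm, this, norm_mul, Complex.norm_real, Real.norm_eq_abs, abs_sub_comm,
      abs_of_pos (by linarith)]
    exact (mul_le_of_le_one_right (by linarith) hz1).trans_lt hrδ
  have h4 := hd (r * z) (by simpa using hrz.trans hr1.le) z hz h3
  rw [h1, ← dist_eq_norm]
  rw [dist_comm] at h2
  linarith [dist_triangle (p.partialSum n (r * z - 0)) (F (r * z)) (F z)]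

theorem norm_le_of_circle {F : ℂ → ℂ} (hF : DiffContOnCl ℂ F (ball 0 1)) {M : ℝ}
    (h : ∀ z, ‖z‖ = 1 → ‖F z‖ ≤ M) {z : ℂ} (hz : z ∈ closedBall (0 : ℂ) 1) : ‖F z‖ ≤ M := by
  refine Complex.norm_le_of_forall_mem_frontier_norm_le isBounded_ball hF (fun w hw => ?_)
    (by rwa [closure_ball (0 : ℂ) one_ne_zero])
  rw [frontier_ball (0 : ℂ) one_ne_zero] at hw
  exact h w (by simpa using hw)

theorem norm_exp_sub_one_le_mul_exp (x : ℂ) :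
    ‖Complex.exp x - 1‖ ≤ ‖x‖ * Real.exp ‖x‖ := by
  simpa using Complex.norm_exp_sub_sum_le_norm_mul_exp x 1

theorem exp_neg_le_norm_exp {x : ℂ} {M : ℝ} (hx : ‖x‖ ≤ M) :
    Real.exp (-M) ≤ ‖Complex.exp x‖ := by
  rw [Complex.norm_exp, Real.exp_le_exp]
  linarith [(abs_le.1 (Complex.abs_re_le_norm x)).1]

/-- Used with `x = d z` and `y` the value of `S P`. The bound is linear in `‖x‖`, so smallness of
`d` in `L²` passes to `1 / (S P) - 1`; the condition on `τ` keeps `y` away from `0`. -/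
theorem norm_inv_sub_one_le {x y : ℂ} {M τ : ℝ} (hx : ‖x‖ ≤ M) (hτ : τ ≤ Real.exp (-M) / 2)
    (hy : ‖y - Complex.exp x‖ ≤ τ) :
    y ≠ 0 ∧ ‖y⁻¹ - 1‖ ≤ 2 * Real.exp M * (Real.exp M * ‖x‖ + τ) := by
  have hpos := Real.exp_pos M
  have h0 : Real.exp (-M) / 2 ≤ ‖y‖ := by
    have h1 := exp_neg_le_norm_exp hx
    have h2 := norm_sub_norm_le (Complex.exp x) y
    rw [norm_sub_rev] at h2
    linarith
  have hy0 : 0 < ‖y‖ := lt_of_lt_of_le (by positivity) h0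
  refine ⟨norm_pos_iff.1 hy0, ?_⟩
  have h1 : y⁻¹ - 1 = y⁻¹ * (1 - y) := by
    have := norm_pos_iff.1 hy0
    field_simp
  have h2 : ‖y⁻¹‖ ≤ 2 * Real.exp M := by
    rw [norm_inv]
    refine inv_le_of_inv_le₀ (by positivity) (le_trans (le_of_eq ?_) h0)
    rw [Real.exp_neg]
    field_simp
  have h3 : ‖1 - y‖ ≤ Real.exp M * ‖x‖ + τ := by
    have h4 : 1 - y = -(Complex.exp x - 1) - (y - Complex.exp x) := by ring
    rw [h4]
    refine (norm_sub_le _ _).trans (add_le_add ?_ hy)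
    rw [norm_neg, mul_comm]
    refine (norm_exp_sub_one_le_mul_exp x).trans ?_
    gcongr
  rw [h1, norm_mul]
  exact mul_le_mul h2 h3 (norm_nonneg _) (by positivity)

/-- Here `δ` depends on `v` but not on `d`, which allows `d` to be chosen afterwards. -/
theorem exists_exp_near_of_near {K : Set ℂ} (hK : IsCompact K) {v : ℂ → ℂ}
    (hv : ContinuousOn v K) {ε : ℝ} (hε : 0 < ε) : ∃ δ > 0, ∀ d : ℂ → ℂ,
      (∀ z ∈ K, ‖d z - v z‖ ≤ δ) → ∀ z ∈ K, ‖Complex.exp (d z) - Complex.exp (v z)‖ ≤ ε := by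
  obtain ⟨A, hA⟩ := hK.exists_bound_of_continuousOn (f := fun z => Complex.exp (v z))
    (Complex.continuous_exp.comp_continuousOn hv)
  have hA1 : ∀ z ∈ K, ‖Complex.exp (v z)‖ ≤ max A 1 := fun z hz =>
    (hA z hz).trans (le_max_left _ _)
  have hA0 : 0 < max A 1 := by positivity
  refine ⟨min 1 (ε / (2 * max A 1)), by positivity, fun d hd z hz => ?_⟩
  have h1 : Complex.exp (d z) - Complex.exp (v z) =
      Complex.exp (v z) * (Complex.exp (d z - v z) - 1) := by
    rw [mul_sub, ← Complex.exp_add]; simp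
  have h2 := Complex.norm_exp_sub_one_le ((hd z hz).trans (min_le_left _ _))
  rw [h1, norm_mul]
  calc _ ≤ max A 1 * (2 * (ε / (2 * max A 1))) :=
        mul_le_mul (hA1 z hz) (h2.trans (by
          gcongr
          exact (hd z hz).trans (min_le_right _ _))) (norm_nonneg _) hA0.le
    _ = ε := by field_simp

/-- Simultaneous zero-free approximation. -/
theorem IsNullCompact.exists_zeroFree {K : Set ℂ} (hK : IsNullCompact K) {G : ℂ → ℂ}
    (hG : ContinuousOn G K) {S : Polynomial ℂ} (hS : ∀ z ∈ closedBall (0 : ℂ) 1, S.eval z ≠ 0)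
    {ε : ℝ} (hε : 0 < ε) :
    ∃ P : Polynomial ℂ, (∀ z ∈ K, ‖(S * P).eval z - G z‖ < ε) ∧
      (∀ z ∈ closedBall (0 : ℂ) 1, (S * P).eval z ≠ 0) ∧
      meanSq (fun z => ((S * P).eval z)⁻¹ - 1) ≤ ε := by
  obtain ⟨v, hv, hvG⟩ := hK.exists_exp_near hG (ε := ε / 4) (by positivity)
  obtain ⟨δ₁, hδ₁, hδv⟩ := exists_exp_near_of_near hK.isCompact hv (ε := ε / 4) (by positivity)
  obtain ⟨M, hM⟩ := hK.exists_near_and_small hv hδ₁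
  -- `B` comes from `(2 e^M (e^M t + τ))² ≤ 8 e^(2M) (e^(2M) t² + τ²)`. Since `M` is fixed before
  -- `δ`, both terms can be made at most `ε / 2`.
  set B : ℝ := 8 * Real.exp M ^ 2 with hB
  have hB0 : 0 < B := by positivity
  obtain ⟨δ, hδ, hδB⟩ : ∃ δ : ℝ, 0 < δ ∧ B * Real.exp M ^ 2 * δ ≤ ε / 2 :=
    ⟨ε / (2 * (B * Real.exp M ^ 2)), by positivity, le_of_eq (by field_simp)⟩
  obtain ⟨d, hd, hdv, hdM, hdm⟩ := hM δ hδ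
  obtain ⟨τ, hτ0, hτε, hτM, hτB⟩ : ∃ τ : ℝ, 0 < τ ∧ τ ≤ ε / 4 ∧ τ ≤ Real.exp (-M) / 2 ∧
      B * τ ^ 2 ≤ ε / 2 := by
    refine ⟨min (ε / 4) (min (Real.exp (-M) / 2) (√(ε / (2 * B)))), by positivity,
      min_le_left _ _, (min_le_right _ _).trans (min_le_left _ _), ?_⟩
    calc _ ≤ B * √(ε / (2 * B)) ^ 2 := by
          gcongr
          exact (min_le_right _ _).trans (min_le_right _ _)
      _ = ε / 2 := by
          rw [sq_sqrt (by positivity)]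
          field_simp
  have hSd : DiffContOnCl ℂ (fun z => S.eval z) (ball 0 1) := S.differentiable.diffContOnCl
  have hcl := closure_ball (0 : ℂ) one_ne_zero
  obtain ⟨A, hA0, hA⟩ := exists_bound_closedBall (F := fun z => S.eval z) S.continuousOn
  have hed : DiffContOnCl ℂ (fun z => Complex.exp (d z)) (ball 0 1) :=
    Complex.differentiable_exp.comp_diffContOnCl hd
  -- `P` approximates `exp d / S`, so that `S P` is uniformly close to the zero-free function `exp
  -- d`.
  obtain ⟨P, hP⟩ := exists_polynomial_near ((hSd.inv (by rwa [hcl])).smul hed)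
    (ε := τ / A) (by positivity)
  have hPexp : ∀ z ∈ closedBall (0 : ℂ) 1, ‖(S * P).eval z - Complex.exp (d z)‖ ≤ τ := by
    intro z hz
    have h1 : (S * P).eval z - Complex.exp (d z) =
        S.eval z * (P.eval z - (S.eval z)⁻¹ * Complex.exp (d z)) := by
      rw [mul_sub, mul_inv_cancel_left₀ (hS z hz), Polynomial.eval_mul]
    rw [h1, norm_mul]
    calc _ ≤ A * (τ / A) := mul_le_mul (hA z hz) (hP z hz).le (norm_nonneg _) hA0.le
      _ = τ := by field_simp
  have hest := fun (z : ℂ) (hz : z ∈ closedBall (0 : ℂ) 1) =>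
    norm_inv_sub_one_le (norm_le_of_circle hd hdM hz) hτM (hPexp z hz)
  refine ⟨P, fun z hz => ?_, fun z hz => (hest z hz).1, ?_⟩
  · have hz1 : z ∈ closedBall (0 : ℂ) 1 := by simp [hK.norm_eq_one z hz]
    have h1 : (S * P).eval z - G z = ((S * P).eval z - Complex.exp (d z)) +
        (Complex.exp (d z) - Complex.exp (v z)) + (Complex.exp (v z) - G z) := by ring
    rw [h1]
    refine (norm_add₃_le).trans_lt ?_
    linarith [hPexp z hz1, hδv d hdv z hz, hvG z hz]
  · have hinv : DiffContOnCl ℂ (fun z => ((S * P).eval z)⁻¹ - 1) (ball 0 1) :=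
      ((S * P).differentiable.diffContOnCl.inv
        (by rw [hcl]; exact fun z hz => (hest z hz).1)).sub_const 1
    have h1 := meanSq_le_affine (diffContOnCl_continuousOn hinv) (diffContOnCl_continuousOn hd)
      (a := B * Real.exp M ^ 2) (b := B * τ ^ 2) fun z hz => by
        have hz1 : z ∈ closedBall (0 : ℂ) 1 := by simp [hz]
        calc _ ≤ (2 * Real.exp M * (Real.exp M * ‖d z‖ + τ)) ^ 2 := by
              gcongr
              exact (hest z hz1).2
          _ ≤ _ := by
              rw [hB]
              nlinarith [mul_nonneg (sq_nonneg (Real.exp M))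
                (sq_nonneg (Real.exp M * ‖d z‖ - τ))]
    refine h1.trans ?_
    have h2 : B * Real.exp M ^ 2 * meanSq d ≤ B * Real.exp M ^ 2 * δ := by gcongr
    linarith

end Hardy

namespace Hardy

open Metric

open Polynomial (X C)

/-! ### Polynomial multiples and the inner product of `H²` -/

namespace H2

theorem fn_sub (f g : H2) (z : 𝔻) : (f - g).fn z = f.fn z - g.fn z := rfl

theorem fn_one (z : 𝔻) : one.fn z = 1 := rfl

theorem fn_polyMul (q : Polynomial ℂ) (f : H2) (z : 𝔻) :
    (polyMul q f).fn z = q.eval (z : ℂ) * f.fn z := rfl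

theorem polyMul_mul (p q : Polynomial ℂ) (f : H2) : polyMul (p * q) f = polyMul p (polyMul q f) :=
  ext fun z => by simp only [fn_polyMul, Polynomial.eval_mul, mul_assoc]

theorem polyMul_one (f : H2) : polyMul 1 f = f :=
  ext fun z => by simp only [fn_polyMul, Polynomial.eval_one, one_mul]

theorem polyMul_sub (q : Polynomial ℂ) (f g : H2) :
    polyMul q (f - g) = polyMul q f - polyMul q g :=
  ext fun z => by simp only [fn_polyMul, fn_sub, mul_sub]

theorem polyMul_X_sub_C (a : ℂ) (f : H2) : polyMul (X - C a) f = polyMul X f - a • f :=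
  ext fun z => by
    simp only [fn_polyMul, fn_sub, fn_smul, Polynomial.eval_sub, Polynomial.eval_X,
      Polynomial.eval_C, sub_mul]

theorem polyMul_one_sub_C_mul_X (a : ℂ) (f : H2) :
    polyMul (1 - C a * X) f = f - a • polyMul X f :=
  ext fun z => by
    simp only [fn_polyMul, fn_sub, fn_smul, Polynomial.eval_sub, Polynomial.eval_X,
      Polynomial.eval_C, Polynomial.eval_one, Polynomial.eval_mul]
    ring

theorem inner_eq_hasSum (f g : H2) :
    HasSum (fun k => star (taylorCoeff f.fn k) * taylorCoeff g.fn k) (inner ℂ f g) := by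
  have h := lp.hasSum_inner (𝕜 := ℂ) (coeffs f) (coeffs g)
  convert! h using 2 with k
  simp [mul_comm]
  rfl

theorem taylorCoeff_polyMul_X (f : H2) : taylorCoeff (polyMul X f).fn =
    fun k => if k = 0 then 0 else taylorCoeff f.fn (k - 1) := by
  refine (of_hasSum fun z => ?_).2
  have := (hasSum_taylorCoeff f.isHardy.1 z).mul_left (z : ℂ)
  rw [← hasSum_nat_add_iff' 1]
  convert! this using 1
  · funext k
    simp
    ring
  · simp [fn_polyMul]

theorem inner_polyMul_X (f g : H2) : inner ℂ (polyMul X f) (polyMul X g) = inner ℂ f g := by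
  refine (inner_eq_hasSum _ _).unique ?_
  rw [taylorCoeff_polyMul_X, taylorCoeff_polyMul_X, ← hasSum_nat_add_iff' 1]
  simpa using inner_eq_hasSum f g

theorem inner_one (f : H2) : inner ℂ one f = f.fn 0 := by
  have h1 : taylorCoeff one.fn = fun k => if k = 0 then 1 else 0 := by
    refine (of_hasSum fun z => ?_).2
    have := hasSum_ite_eq (0 : ℕ) (1 : ℂ)
    convert! this using 2 with k
    by_cases hk : k = 0 <;> simp [hk]
  refine (inner_eq_hasSum _ _).unique ?_
  rw [h1]
  have h2 : taylorCoeff f.fn 0 = f.fn 0 := by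
    simpa [taylorCoeff] using extend_coe f.fn 0
  rw [← h2]
  convert! hasSum_ite_eq (0 : ℕ) (taylorCoeff f.fn 0) using 2 with k
  by_cases hk : k = 0 <;> simp [hk]

end H2

/-- The monic polynomial with the given roots. -/
def rootPoly (s : Multiset ℂ) : Polynomial ℂ := (s.map fun a => X - C a).prod

/-- The polynomial whose roots are the reflections of the given points in the unit circle. -/
def reflectedPoly (s : Multiset ℂ) : Polynomial ℂ :=
  (s.map fun a => 1 - C ((starRingEnd ℂ) a) * X).prod

/-- The quotient `rootPoly s / reflectedPoly s` is unimodular on the circle. -/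
theorem inner_rootPoly (s : Multiset ℂ) (f g : H2) :
    inner ℂ (H2.polyMul (rootPoly s) f) (H2.polyMul (rootPoly s) g) =
      inner ℂ (H2.polyMul (reflectedPoly s) f) (H2.polyMul (reflectedPoly s) g) := by
  induction s using Multiset.induction_on generalizing f g with
  | empty => simp [rootPoly, reflectedPoly]
  | cons a s ih =>
    have h1 : rootPoly (a ::ₘ s) = rootPoly s * (X - C a) := by
      simp [rootPoly, mul_comm]
    have h2 : reflectedPoly (a ::ₘ s) = (1 - C ((starRingEnd ℂ) a) * X) * reflectedPoly s := by
      simp [reflectedPoly]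
    -- Multiplication by `z` is isometric, so both sides expand to the same four terms.
    have h3 : ∀ u v : H2, inner ℂ (H2.polyMul (X - C a) u) (H2.polyMul (X - C a) v) =
        inner ℂ (H2.polyMul (1 - C ((starRingEnd ℂ) a) * X) u)
          (H2.polyMul (1 - C ((starRingEnd ℂ) a) * X) v) := fun u v => by
      simp only [H2.polyMul_X_sub_C, H2.polyMul_one_sub_C_mul_X, inner_sub_left, inner_sub_right,
        inner_smul_left, inner_smul_right, H2.inner_polyMul_X, Complex.conj_conj]
      ring
    rw [h1, H2.polyMul_mul, H2.polyMul_mul, ih, ← H2.polyMul_mul, ← H2.polyMul_mul,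
      mul_comm (reflectedPoly s), H2.polyMul_mul, H2.polyMul_mul, h3, h2, H2.polyMul_mul,
      H2.polyMul_mul]

theorem reflectedPoly_eval_ne_zero {s : Multiset ℂ} (hs : ∀ a ∈ s, ‖a‖ < 1) {z : ℂ}
    (hz : z ∈ closedBall (0 : ℂ) 1) : (reflectedPoly s).eval z ≠ 0 := by
  rw [reflectedPoly, Polynomial.eval_multiset_prod, Multiset.map_map]
  refine Multiset.prod_ne_zero fun h0 => ?_
  obtain ⟨a, ha, h1⟩ := Multiset.mem_map.1 h0
  simp [sub_eq_zero] at h1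
  have h2 : ‖(starRingEnd ℂ) a * z‖ < 1 := by
    rw [norm_mul, RCLike.norm_conj]
    have hz1 : ‖z‖ ≤ 1 := by simpa using hz
    exact (mul_le_of_le_one_right (norm_nonneg a) hz1).trans_lt (hs a ha)
  rw [← h1] at h2
  simp at h2

theorem reflectedPoly_eval_zero (s : Multiset ℂ) : (reflectedPoly s).eval 0 = 1 := by
  simp [reflectedPoly, Polynomial.eval_multiset_prod, Multiset.map_map]

theorem rootPoly_eval_zero_ne_zero {s : Multiset ℂ} (hs : ∀ a ∈ s, a ≠ 0) :
    (rootPoly s).eval 0 ≠ 0 := by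
  rw [rootPoly, Polynomial.eval_multiset_prod, Multiset.map_map]
  refine Multiset.prod_ne_zero fun h0 => ?_
  obtain ⟨a, ha, h1⟩ := Multiset.mem_map.1 h0
  simp at h1
  exact hs a ha h1

theorem diffContOnCl_eval (q : Polynomial ℂ) : DiffContOnCl ℂ (fun z => q.eval z) (ball 0 1) :=
  q.differentiable.diffContOnCl

theorem diffContOnCl_inv_eval {q : Polynomial ℂ}
    (hq : ∀ z ∈ closedBall (0 : ℂ) 1, q.eval z ≠ 0) :
    DiffContOnCl ℂ (fun z => (q.eval z)⁻¹) (ball 0 1) :=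
  (diffContOnCl_eval q).inv (by rwa [closure_ball (0 : ℂ) one_ne_zero])

theorem coe_mem_closedBall (z : 𝔻) : (z : ℂ) ∈ closedBall (0 : ℂ) 1 := by
  simpa using z.norm_lt_one.le

/-- The optimal approximants of `B / P`, with `B` a finite Blaschke product and `P` a polynomial
without zeros in the closed disc, are multiples of `P`. -/
theorem isOPA_blaschke_div {s : Multiset ℂ} {P : Polynomial ℂ}
    (hP : ∀ z ∈ closedBall (0 : ℂ) 1, (reflectedPoly s * P).eval z ≠ 0) {n : ℕ}
    (hn : P.natDegree ≤ n) :
    IsOPA (H2.polyMul (rootPoly s) (ofDisc _ (diffContOnCl_inv_eval hP))) n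
      (C ((starRingEnd ℂ) ((rootPoly s).eval 0)) * P) := by
  set c := (starRingEnd ℂ) ((rootPoly s).eval 0) with hc
  set g := ofDisc _ (diffContOnCl_inv_eval hP) with hg
  refine ⟨(Polynomial.natDegree_C_mul_le _ _).trans hn, fun q _ => ?_⟩
  set h := H2.polyMul (q - C c * P) g with hh
  -- Any competitor differs from the candidate by a multiple of `rootPoly s`, and the error of the
  -- candidate is orthogonal to it; Pythagoras concludes.
  have hq : H2.polyMul q (H2.polyMul (rootPoly s) g) - H2.one =
      (H2.polyMul (C c * P) (H2.polyMul (rootPoly s) g) - H2.one) +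
        H2.polyMul (rootPoly s) h := H2.ext fun z => by
    simp only [hh, H2.fn_add, H2.fn_sub, H2.fn_polyMul, Polynomial.eval_sub]
    ring
  have hcP : H2.polyMul (C c * P) (H2.polyMul (rootPoly s) g) =
      c • H2.polyMul (rootPoly s) (H2.polyMul P g) := H2.ext fun z => by
    simp only [H2.fn_smul, H2.fn_polyMul, Polynomial.eval_mul, Polynomial.eval_C]
    ring
  have hone : H2.polyMul (reflectedPoly s) (H2.polyMul P g) = H2.one := H2.ext fun z => by
    rw [← H2.polyMul_mul, H2.fn_polyMul, H2.fn_one, hg, fn_ofDisc]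
    exact mul_inv_cancel₀ (hP z (coe_mem_closedBall z))
  -- Replacing `rootPoly s` by `reflectedPoly s` on both sides turns the first factor `rootPoly s *
  -- P * g` into `1`. Both inner products are then values at `0`, which agree by the choice of `c`.
  have horth : inner ℂ (H2.polyMul (C c * P) (H2.polyMul (rootPoly s) g) - H2.one)
      (H2.polyMul (rootPoly s) h) = 0 := by
    rw [hcP, inner_sub_left, inner_smul_left, inner_rootPoly, hone, H2.inner_one, H2.inner_one,
      H2.fn_polyMul (reflectedPoly s) h, H2.fn_polyMul (rootPoly s) h, hc, Complex.conj_conj,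
      Complex.UnitDisc.coe_zero,
      reflectedPoly_eval_zero, one_mul, sub_self]
  rw [hq, ← sq_le_sq₀ (norm_nonneg _) (norm_nonneg _), norm_add_sq (𝕜 := ℂ), horth]
  simp

/-! ### Completeness of `H²` and density of polynomials -/

namespace H2

theorem isometry_coeffs : Isometry coeffs :=
  Isometry.of_dist_eq fun _ _ => rfl

theorem coeffs_surjective : Function.Surjective coeffs := fun a => by
  have hs : ∀ z : 𝔻, HasSum (fun k => a k * (z : ℂ) ^ k) (∑' k, a k * (z : ℂ) ^ k) := fun z => by
    refine Summable.hasSum (Summable.of_norm_bounded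
      ((summable_geometric_of_lt_one (norm_nonneg (z : ℂ)) z.norm_lt_one).mul_left ‖a‖)
      fun k => ?_)
    rw [norm_mul, norm_pow]
    gcongr
    exact lp.norm_apply_le_norm two_ne_zero a k
  exact ⟨mk _ (isHardy_of_hasSum (memlp_iff.1 (lp.memℓp a)) hs), Subtype.ext (of_hasSum hs).2⟩

/-- Completeness, inherited from `ℓ²`, is what makes the Baire theorem available. -/
instance : CompleteSpace H2 :=
  (isometry_coeffs.isUniformInducing.completeSpace_congr coeffs_surjective).2 inferInstance

theorem coeffs_polyMul_monomial (k : ℕ) (c : ℂ) :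
    coeffs (polyMul (Polynomial.monomial k c) one) = lp.single 2 k c := by
  refine Subtype.ext ?_
  have h : taylorCoeff (polyMul (Polynomial.monomial k c) one).fn = Pi.single k c :=
    (of_hasSum fun z => by
      have := hasSum_single (f := fun j => (Pi.single k c : ℕ → ℂ) j * (z : ℂ) ^ j) k
        fun j hj => by simp [hj]
      simpa [fn_polyMul, fn_one] using this).2
  exact h.trans (lp.coeFn_single (E := fun _ : ℕ => ℂ) 2 k c).symm

theorem exists_polynomial_near (f : H2) {ε : ℝ} (hε : 0 < ε) :
    ∃ q : Polynomial ℂ, ‖polyMul q one - f‖ < ε := by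
  have h := lp.hasSum_single (p := 2) (by simp) (coeffs f)
  obtain ⟨s, hs⟩ := (Metric.tendsto_nhds.1 h ε hε).exists
  refine ⟨∑ k ∈ s, Polynomial.monomial k (coeffs f k), ?_⟩
  have h1 : coeffs (polyMul (∑ k ∈ s, Polynomial.monomial k (coeffs f k)) one) =
      ∑ k ∈ s, lp.single 2 k (coeffs f k) := by
    change coeffs (polyMulLin one _) = _
    rw [map_sum, map_sum]
    exact Finset.sum_congr rfl fun k _ => coeffs_polyMul_monomial k _
  rw [← dist_eq_norm, ← isometry_coeffs.dist_eq, h1]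
  exact hs

end H2

theorem norm_ofDisc_le {F : ℂ → ℂ} (hF : DiffContOnCl ℂ F (ball 0 1)) {B : ℝ} (hB : 0 ≤ B)
    (h : ∀ z, ‖z‖ = 1 → ‖F z‖ ≤ B) : ‖ofDisc F hF‖ ≤ B := by
  rw [← sq_le_sq₀ (norm_nonneg _) hB]
  refine (norm_sq_ofDisc_le hF).trans (meanSq_le_of_norm_le (diffContOnCl_continuousOn hF)
    fun z hz => ?_)
  gcongr
  exact h z hz

theorem polyMul_one_eq_ofDisc (q : Polynomial ℂ) :
    H2.polyMul q H2.one = ofDisc _ (diffContOnCl_eval q) :=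
  H2.ext fun z => by rw [H2.fn_polyMul, H2.fn_one, mul_one, fn_ofDisc]

theorem norm_polyMul_one_sub_le (p q : Polynomial ℂ) {B : ℝ} (hB : 0 ≤ B)
    (h : ∀ z, ‖z‖ = 1 → ‖p.eval z - q.eval z‖ ≤ B) :
    ‖H2.polyMul p H2.one - H2.polyMul q H2.one‖ ≤ B := by
  have h1 : H2.polyMul p H2.one - H2.polyMul q H2.one = H2.polyMul (p - q) H2.one :=
    (map_sub (H2.polyMulLin H2.one) p q).symm
  rw [h1, polyMul_one_eq_ofDisc]
  exact norm_ofDisc_le _ hB (by simpa using h)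

/-- The zeros of `q` have finitely many moduli, and any other `r` close enough to `1` will do. The
alternative `q = 0` is kept because the zero polynomial has an empty root multiset. -/
theorem exists_dilation_near (q : Polynomial ℂ) {ε : ℝ} (hε : 0 < ε) :
    ∃ r : ℝ, 0 < r ∧ (∀ z : ℂ, ‖z‖ = 1 → q.eval (r * z) ≠ 0 ∨ q = 0) ∧
      ∀ z : ℂ, ‖z‖ = 1 → ‖q.eval (r * z) - q.eval z‖ ≤ ε := by
  have huc := (isCompact_closedBall (0 : ℂ) 1).uniformContinuousOn_of_continuous
    q.continuous.continuousOn
  obtain ⟨δ, hδ, hd⟩ := Metric.uniformContinuousOn_iff.1 huc ε hε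
  obtain ⟨r, ⟨hr0, hr1⟩, hroot⟩ : ∃ r ∈ Set.Ioo (max 0 (1 - δ)) 1,
      r ∉ ((q.roots.toFinset.image norm : Finset ℝ) : Set ℝ) := by
    have hlt : max 0 (1 - δ) < 1 := max_lt one_pos (by linarith)
    exact ((Set.Ioo_infinite hlt).sdiff (Finset.finite_toSet _)).nonempty
  have hpos : 0 < r := (le_max_left _ _).trans_lt hr0
  have hnorm : ∀ z : ℂ, ‖z‖ = 1 → ‖(r : ℂ) * z‖ = r := fun z hz => by
    rw [norm_mul, hz, mul_one, Complex.norm_real, Real.norm_eq_abs, abs_of_pos hpos]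
  refine ⟨r, hpos, fun z hz => ?_, fun z hz => ?_⟩
  · by_contra! hcon
    refine hroot ?_
    rw [Finset.mem_coe, Finset.mem_image]
    exact ⟨r * z, by simpa [hcon.2] using hcon.1, hnorm z hz⟩
  · rw [← dist_eq_norm]
    refine (hd _ (by simpa [mul_comm] using (hnorm z hz).le.trans hr1.le) _ (by simp [hz]) ?_).le
    have : (r : ℂ) * z - z = ((r - 1 : ℝ) : ℂ) * z := by push_cast; ring
    rw [dist_eq_norm, this, norm_mul, hz, mul_one, Complex.norm_real, Real.norm_eq_abs,
      abs_sub_comm, abs_of_pos (by linarith)]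
    linarith [(le_max_right 0 (1 - δ)).trans_lt hr0]

/-- Polynomials without zeros on the circle and at the origin are dense in `H²`. -/
theorem exists_zeroFree_polynomial_near (f : H2) {ε : ℝ} (hε : 0 < ε) :
    ∃ q : Polynomial ℂ, ‖H2.polyMul q H2.one - f‖ < ε ∧ q.eval 0 ≠ 0 ∧
      ∀ z, ‖z‖ = 1 → q.eval z ≠ 0 := by
  obtain ⟨q₀, hq₀⟩ := H2.exists_polynomial_near f (ε := ε / 3) (by positivity)
  -- A small constant makes the value at the origin non-zero, and the dilation that follows
  -- preserves that value.
  obtain ⟨η, hη, hη0⟩ : ∃ η : ℂ, ‖η‖ ≤ ε / 4 ∧ q₀.eval 0 + η ≠ 0 := by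
    by_cases h0 : q₀.eval 0 = 0
    · refine ⟨((ε / 4 : ℝ) : ℂ), ?_, ?_⟩
      · rw [Complex.norm_real, Real.norm_eq_abs, abs_of_pos (by positivity)]
      · rw [h0, zero_add, Complex.ofReal_ne_zero]
        positivity
    · exact ⟨0, by rw [norm_zero]; positivity, by simpa using h0⟩
  obtain ⟨r, hr0, hr, hrd⟩ := exists_dilation_near (q₀ + C η) (ε := ε / 4) (by positivity)
  have hne : q₀ + C η ≠ 0 := fun h => hη0 (by simpa using congrArg (Polynomial.eval 0) h)
  have hev : ∀ z : ℂ, ((q₀ + C η).comp (C (r : ℂ) * X)).eval z = (q₀ + C η).eval (r * z) :=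
    fun z => by simp [Polynomial.eval_comp]
  refine ⟨(q₀ + C η).comp (C (r : ℂ) * X), ?_, ?_, fun z hz => ?_⟩
  · have h1 := norm_polyMul_one_sub_le ((q₀ + C η).comp (C (r : ℂ) * X)) (q₀ + C η)
      (B := ε / 4) (by positivity) fun z hz => by rw [hev]; exact hrd z hz
    have h2 := norm_polyMul_one_sub_le (q₀ + C η) q₀ (B := ε / 4) (by positivity)
      fun z _ => by simpa using hη
    have h3 : ∀ a b c d : H2, a - d = (a - b) + (b - c) + (c - d) := fun a b c d => by abel
    rw [h3 _ (H2.polyMul (q₀ + C η) H2.one) (H2.polyMul q₀ H2.one)]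
    refine (norm_add₃_le).trans_lt ?_
    linarith
  · rw [hev]
    simpa using hη0
  · rw [hev]
    exact (hr z hz).resolve_right hne

/-- A polynomial without zeros on the circle and at the origin splits off its zeros in the
disc. -/
theorem exists_eq_rootPoly_mul {q : Polynomial ℂ} (hq0 : q.eval 0 ≠ 0)
    (hq : ∀ z, ‖z‖ = 1 → q.eval z ≠ 0) :
    ∃ (s : Multiset ℂ) (F : Polynomial ℂ), q = rootPoly s * F ∧ (∀ a ∈ s, ‖a‖ < 1) ∧
      (∀ a ∈ s, a ≠ 0) ∧ ∀ z ∈ closedBall (0 : ℂ) 1, F.eval z ≠ 0 := by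
  classical
  have hne : q ≠ 0 := fun h => hq0 (by simp [h])
  have hfac := (IsAlgClosed.splits q).eq_prod_roots
  refine ⟨q.roots.filter fun a => ‖a‖ < 1,
    C q.leadingCoeff * rootPoly (q.roots.filter fun a => ¬ ‖a‖ < 1), ?_, fun a ha => ?_,
    fun a ha => ?_, fun z hz => ?_⟩
  · conv_lhs => rw [hfac, ← Multiset.filter_add_not (fun a : ℂ => ‖a‖ < 1) q.roots]
    rw [Multiset.map_add, Multiset.prod_add, rootPoly, rootPoly]
    ring
  · exact (Multiset.mem_filter.1 ha).2
  · rintro rfl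
    exact hq0 (Polynomial.isRoot_of_mem_roots (Multiset.mem_filter.1 ha).1)
  · rw [Polynomial.eval_mul, Polynomial.eval_C]
    refine mul_ne_zero (Polynomial.leadingCoeff_ne_zero.2 hne) ?_
    rw [rootPoly, Polynomial.eval_multiset_prod, Multiset.map_map]
    refine Multiset.prod_ne_zero fun h0 => ?_
    obtain ⟨a, ha, h1⟩ := Multiset.mem_map.1 h0
    obtain ⟨ha1, ha2⟩ := Multiset.mem_filter.1 ha
    have h2 : z = a := by simpa [sub_eq_zero] using h1
    subst h2
    have hz1 : ‖z‖ ≤ 1 := by simpa using hz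
    exact hq z (le_antisymm hz1 (not_lt.1 ha2)) (Polynomial.isRoot_of_mem_roots ha1)

/-- Functions whose optimal approximants are eventually close to a given function on a null set
are dense. -/
theorem IsNullCompact.exists_near_isOPA {K : Set ℂ} (hK : IsNullCompact K) {g : ℂ → ℂ}
    (hg : ContinuousOn g K) (f : H2) {ε δ : ℝ} (hε : 0 < ε) (hδ : 0 < δ) :
    ∃ f' : H2, ‖f' - f‖ < ε ∧ f' ≠ 0 ∧ ∃ (Q : Polynomial ℂ) (n₀ : ℕ),
      (∀ n ≥ n₀, IsOPA f' n Q) ∧ ∀ z ∈ K, ‖Q.eval z - g z‖ ≤ δ := by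
  obtain ⟨q, hqf, hq0, hq1⟩ := exists_zeroFree_polynomial_near f (half_pos hε)
  obtain ⟨s, F, hqF, hs1, hs0, hF⟩ := exists_eq_rootPoly_mul hq0 hq1
  set c := (starRingEnd ℂ) ((rootPoly s).eval 0) with hc
  have hc0 : c ≠ 0 := by simpa [hc] using rootPoly_eval_zero_ne_zero hs0
  set S := reflectedPoly s * F with hS
  have hSne : ∀ z ∈ closedBall (0 : ℂ) 1, S.eval z ≠ 0 := fun z hz => by
    rw [hS, Polynomial.eval_mul]
    exact mul_ne_zero (reflectedPoly_eval_ne_zero hs1 hz) (hF z hz)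
  obtain ⟨A, hA0, hA⟩ := exists_bound_closedBall (F := fun z => q.eval z) q.continuousOn
  obtain ⟨B, hB0, hB⟩ := exists_bound_closedBall (F := fun z => c * (S.eval z)⁻¹)
    (continuousOn_const.mul (diffContOnCl_continuousOn (diffContOnCl_inv_eval hSne)))
  obtain ⟨τ, hτ0, hτA, hτB⟩ : ∃ τ : ℝ, 0 < τ ∧ A ^ 2 * τ ≤ (ε / 4) ^ 2 ∧ B * τ ≤ δ := by
    refine ⟨min ((ε / 4) ^ 2 / A ^ 2) (δ / B), by positivity, ?_, ?_⟩
    · calc _ ≤ A ^ 2 * ((ε / 4) ^ 2 / A ^ 2) := by gcongr; exact min_le_left _ _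
        _ = _ := by field_simp
    · calc _ ≤ B * (δ / B) := by gcongr; exact min_le_right _ _
        _ = _ := by field_simp
  -- The optimal approximant will be `c P`, which is close to `g` when `S P` is close to `g S / c`;
  -- the zero-free origin is what makes `c ≠ 0`.
  obtain ⟨P, hPK, hPne, hPm⟩ := hK.exists_zeroFree (G := fun z => g z * S.eval z / c)
    ((hg.mul S.continuousOn).div_const c) hSne hτ0
  have hP : ∀ z ∈ closedBall (0 : ℂ) 1, (reflectedPoly s * P).eval z ≠ 0 := fun z hz h0 => by
    refine hPne z hz ?_
    rw [hS, mul_right_comm, Polynomial.eval_mul, h0, zero_mul]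
  refine ⟨H2.polyMul (rootPoly s) (ofDisc _ (diffContOnCl_inv_eval hP)), ?_, fun h0 => ?_,
    C c * P, P.natDegree, fun n hn => isOPA_blaschke_div hP hn, fun z hz => ?_⟩
  · have hd : DiffContOnCl ℂ (fun z => q.eval z * (((S * P).eval z)⁻¹ - 1)) (ball 0 1) :=
      (diffContOnCl_eval q).smul ((diffContOnCl_inv_eval hPne).sub_const 1)
    -- The factor `F` cancels in `q / (S P)`, so the new function minus `q` is `q (1 / (S P) - 1)`.
    have h1 : H2.polyMul (rootPoly s) (ofDisc _ (diffContOnCl_inv_eval hP)) -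
        H2.polyMul q H2.one = ofDisc _ hd := H2.ext fun z => by
      rw [H2.fn_sub, H2.fn_polyMul, H2.fn_polyMul, fn_ofDisc, fn_ofDisc, H2.fn_one, hqF, hS]
      have h2 := hF z (coe_mem_closedBall z)
      have h3 := hP z (coe_mem_closedBall z)
      simp only [Polynomial.eval_mul] at h3 ⊢
      have h4 := left_ne_zero_of_mul h3
      have h5 := right_ne_zero_of_mul h3
      field_simp
    have h2 : ‖ofDisc _ hd‖ ≤ ε / 4 := by
      rw [← sq_le_sq₀ (norm_nonneg _) (by positivity)]
      refine (norm_sq_ofDisc_le hd).trans ?_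
      refine (meanSq_le_affine (diffContOnCl_continuousOn hd) (diffContOnCl_continuousOn
        ((diffContOnCl_inv_eval hPne).sub_const 1)) (a := A ^ 2) (b := 0) fun z hz => ?_).trans ?_
      · rw [norm_mul, mul_pow, add_zero]
        gcongr
        exact hA z (by simp [hz])
      · rw [add_zero]
        exact (mul_le_mul_of_nonneg_left hPm (by positivity)).trans hτA
    rw [← sub_add_sub_cancel _ (H2.polyMul q H2.one), h1]
    refine (norm_add_le _ _).trans_lt ?_
    linarith
  · have h1 : (rootPoly s).eval 0 * ((reflectedPoly s * P).eval 0)⁻¹ = 0 :=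
      congrArg (fun h : H2 => h.fn 0) h0
    exact mul_ne_zero (rootPoly_eval_zero_ne_zero hs0) (inv_ne_zero (hP 0 (by simp))) h1
  · have hz1 : z ∈ closedBall (0 : ℂ) 1 := by simp [hK.norm_eq_one z hz]
    have h1 : (C c * P).eval z - g z =
        c * (S.eval z)⁻¹ * ((S * P).eval z - g z * S.eval z / c) := by
      have := hSne z hz1
      simp only [Polynomial.eval_mul, Polynomial.eval_C]
      field_simp
    rw [h1, norm_mul]
    exact (mul_le_mul (hB z hz1) (hPK z hz).le (norm_nonneg _) hB0.le).trans hτB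

/-! ### Continuous dependence of the optimal approximants -/

namespace H2

theorem norm_polyMul_X_pow (n : ℕ) (f : H2) : ‖polyMul (X ^ n) f‖ = ‖f‖ := by
  induction n with
  | zero => rw [pow_zero, polyMul_one]
  | succ n ih =>
    rw [pow_succ', polyMul_mul, ← ih, @norm_eq_sqrt_re_inner ℂ, inner_polyMul_X,
      ← @norm_eq_sqrt_re_inner ℂ]

theorem continuous_polyMul_X_pow (n : ℕ) : Continuous (polyMul (X ^ n)) :=
  (Isometry.of_dist_eq fun f g => by
    rw [dist_eq_norm, dist_eq_norm, ← polyMul_sub, norm_polyMul_X_pow]).continuous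

end H2

/-- The Gram matrix of `f, z f, …, zⁿ f`. -/
def gramMatrix (n : ℕ) (f : H2) : Matrix (Fin (n + 1)) (Fin (n + 1)) ℂ := fun i j =>
  inner ℂ (H2.polyMul (X ^ (i : ℕ)) f) (H2.polyMul (X ^ (j : ℕ)) f)

/-- The inner products of `f, z f, …, zⁿ f` with `1`. -/
def gramVector (n : ℕ) (f : H2) : Fin (n + 1) → ℂ := fun i =>
  inner ℂ (H2.polyMul (X ^ (i : ℕ)) f) H2.one

theorem continuous_gramMatrix (n : ℕ) : Continuous (gramMatrix n) :=
  continuous_pi fun i => continuous_pi fun j =>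
    (H2.continuous_polyMul_X_pow i).inner (H2.continuous_polyMul_X_pow j)

theorem continuous_gramVector (n : ℕ) : Continuous (gramVector n) :=
  continuous_pi fun i => (H2.continuous_polyMul_X_pow i).inner continuous_const

theorem sum_smul_polyMul_X_pow (n : ℕ) (f : H2) (c : Fin (n + 1) → ℂ) :
    ∑ j, c j • H2.polyMul (X ^ (j : ℕ)) f =
      H2.polyMul (∑ j : Fin (n + 1), Polynomial.monomial (j : ℕ) (c j)) f := by
  change _ = H2.polyMulLin f _
  rw [map_sum]
  refine Finset.sum_congr rfl fun j _ => ?_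
  rw [← mul_one (c j), ← smul_eq_mul, ← Polynomial.smul_monomial, map_smul,
    Polynomial.monomial_one_right_eq_X_pow, smul_eq_mul, mul_one]
  rfl

theorem gramMatrix_mulVec (n : ℕ) (f : H2) (c : Fin (n + 1) → ℂ) (i : Fin (n + 1)) :
    (gramMatrix n f).mulVec c i = inner ℂ (H2.polyMul (X ^ (i : ℕ)) f)
      (H2.polyMul (∑ j : Fin (n + 1), Polynomial.monomial (j : ℕ) (c j)) f) := by
  rw [← sum_smul_polyMul_X_pow, inner_sum]
  simp only [Matrix.mulVec, dotProduct, gramMatrix, inner_smul_right, mul_comm]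

/-- A kernel vector gives a polynomial `q` with `‖q f‖² = 0`, and a non-zero `f` is annihilated by
no non-zero polynomial. -/
theorem det_gramMatrix_ne_zero (n : ℕ) {f : H2} (hf : f ≠ 0) : (gramMatrix n f).det ≠ 0 := by
  intro h0
  obtain ⟨c, hc, h⟩ := Matrix.exists_mulVec_eq_zero_iff.2 h0
  set q : Polynomial ℂ := ∑ j : Fin (n + 1), Polynomial.monomial (j : ℕ) (c j) with hq
  have h1 : inner ℂ (H2.polyMul q f) (H2.polyMul q f) = 0 := by
    conv_lhs => rw [hq, ← sum_smul_polyMul_X_pow, sum_inner, sum_smul_polyMul_X_pow]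
    refine Finset.sum_eq_zero fun i _ => ?_
    rw [inner_smul_left, ← gramMatrix_mulVec, h]
    simp
  have h2 : q = 0 := H2.polyMul_injective hf
    ((inner_self_eq_zero (𝕜 := ℂ)).1 h1 |>.trans (map_zero (H2.polyMulLin f)).symm)
  refine hc (funext fun i => ?_)
  have h3 := congrArg (fun p => Polynomial.coeff p (i : ℕ)) h2
  simpa [hq, Polynomial.finsetSum_coeff, Polynomial.coeff_monomial, Fin.val_inj] using h3

/-- These are the normal equations: `1 - Q f` is orthogonal to each `z ^ i f` with `i ≤ n`. -/
theorem gramMatrix_mulVec_opa (n : ℕ) (f : H2) :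
    (gramMatrix n f).mulVec (fun j => (opa f n).coeff j) = gramVector n f := by
  obtain ⟨h1, h2⟩ := isOPA_iff.1 (isOPA_opa f n)
  have h3 : ∑ j : Fin (n + 1), Polynomial.monomial (j : ℕ) ((opa f n).coeff j) = opa f n := by
    rw [Fin.sum_univ_eq_sum_range (fun j => Polynomial.monomial j ((opa f n).coeff j))]
    exact ((opa f n).as_sum_range' (n + 1) (Nat.lt_succ_of_le h1)).symm
  funext i
  rw [gramMatrix_mulVec, h3, h2, gramVector]
  have hmem : H2.polyMul (X ^ (i : ℕ)) f ∈ polySpan f n :=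
    mem_polySpan.2 ⟨X ^ (i : ℕ), (Polynomial.natDegree_X_pow_le _).trans
      (Nat.le_of_lt_succ i.2), rfl⟩
  have := (polySpan f n).starProjection_inner_eq_zero H2.one _ hmem
  have h4 := inner_eq_zero_symm.1 this
  rw [inner_sub_right, sub_eq_zero] at h4
  exact h4.symm

/-- Cramer's rule in adjugate form, from which continuity in `f` can be read off. -/
theorem opa_coeff_eq (n : ℕ) {f : H2} (hf : f ≠ 0) :
    (fun j : Fin (n + 1) => (opa f n).coeff j) =
      (gramMatrix n f).det⁻¹ • (gramMatrix n f).adjugate.mulVec (gramVector n f) := by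
  rw [← gramMatrix_mulVec_opa, Matrix.mulVec_mulVec, Matrix.adjugate_mul, Matrix.smul_mulVec,
    Matrix.one_mulVec, inv_smul_smul₀ (det_gramMatrix_ne_zero n hf)]

theorem continuousOn_opa_coeff (n : ℕ) (j : Fin (n + 1)) :
    ContinuousOn (fun f : H2 => (opa f n).coeff j) {f | f ≠ 0} := by
  have h1 : ContinuousOn (fun f : H2 =>
      (gramMatrix n f).det⁻¹ • (gramMatrix n f).adjugate.mulVec (gramVector n f)) {f | f ≠ 0} := by
    refine ContinuousOn.smul (ContinuousOn.inv₀ ?_ fun f hf => det_gramMatrix_ne_zero n hf) ?_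
    · exact (continuous_gramMatrix n).matrix_det.continuousOn
    · exact ((continuous_gramMatrix n).matrix_adjugate.matrix_mulVec
        (continuous_gramVector n)).continuousOn
  exact ((continuous_apply j).comp_continuousOn h1).congr fun f hf =>
    congrFun (opa_coeff_eq n hf) j

/-- The optimal approximant of order `n`, as a continuous function on a subset of the circle. -/
def opaOn (E : Set Circle) (n : ℕ) (f : H2) : C(E, ℂ) where
  toFun z := (opa f n).eval ((z : Circle) : ℂ)
  continuous_toFun := (opa f n).continuous.comp (by fun_prop)

theorem continuousOn_opaOn (E : Set Circle) [CompactSpace E] (n : ℕ) :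
    ContinuousOn (opaOn E n) {f | f ≠ 0} := by
  have h1 : opaOn E n = fun f => ∑ j : Fin (n + 1), (opa f n).coeff j •
      (⟨fun z => ((z : Circle) : ℂ) ^ (j : ℕ), by fun_prop⟩ : C(E, ℂ)) := by
    funext f
    ext z
    rw [ContinuousMap.coe_sum, Finset.sum_apply]
    change (opa f n).eval _ = ∑ j : Fin (n + 1), (opa f n).coeff j * ((z : Circle) : ℂ) ^ (j : ℕ)
    rw [Fin.sum_univ_eq_sum_range (fun j => (opa f n).coeff j * ((z : Circle) : ℂ) ^ j)]
    exact Polynomial.eval_eq_sum_range' (Nat.lt_succ_of_le (isOPA_opa f n).1) _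
  rw [h1]
  exact continuousOn_finsetSum _ fun j _ => (continuousOn_opa_coeff n j).smul continuousOn_const

/-! ### The Baire category argument -/

/-- The non-zero functions with an optimal approximant of order at least `N` that is `ε`-close to
`g` on `E`. -/
def nearOPA (E : Set Circle) [CompactSpace E] (g : C(E, ℂ)) (ε : ℝ) (N : ℕ) : Set H2 :=
  ⋃ n ≥ N, {f | f ≠ 0} ∩ opaOn E n ⁻¹' ball g ε

theorem isOpen_nearOPA (E : Set Circle) [CompactSpace E] (g : C(E, ℂ)) (ε : ℝ) (N : ℕ) :
    IsOpen (nearOPA E g ε N) :=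
  isOpen_biUnion fun n _ =>
    (continuousOn_opaOn E n).isOpen_inter_preimage isOpen_ne isOpen_ball

/-- Asking for indices beyond every `N` makes each `g` a cluster point of the sequence of
approximants, hence the limit of a subsequence; a dense sequence of targets suffices. -/
theorem universalOPA_eq (E : Set Circle) [CompactSpace E] :
    universalOPA E = ⋂ i : ℕ × ℕ × ℕ,
      nearOPA E (TopologicalSpace.denseSeq C(E, ℂ) i.1) (1 / (i.2.1 + 1)) i.2.2 := by
  ext f
  have htend : ∀ (m : ℕ → ℕ) (g : C(E, ℂ)),
      TendstoUniformly (fun (s : ℕ) (z : E) => (opa f (m s)).eval ((z : Circle) : ℂ)) g atTop ↔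
        Tendsto (fun s => opaOn E (m s) f) atTop (𝓝 g) := fun m g =>
    (ContinuousMap.tendsto_iff_tendstoUniformly (F := fun s => opaOn E (m s) f)).symm
  simp only [universalOPA, Set.mem_iInter, nearOPA, Set.mem_iUnion]
  constructor
  · rintro ⟨hf, h⟩ ⟨j, k, N⟩
    obtain ⟨m, hm, ht⟩ := h (TopologicalSpace.denseSeq C(E, ℂ) j)
    obtain ⟨s, hs1, hs2⟩ := ((Metric.tendsto_nhds.1 ((htend _ _).1 ht) (1 / ((k : ℝ) + 1))
      (by positivity)).and (eventually_ge_atTop N)).exists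
    exact ⟨m s, hs2.trans hm.le_apply, hf, hs1⟩
  · intro h
    obtain ⟨n, -, hf, -⟩ := h (0, 0, 0)
    refine ⟨hf, fun g => ?_⟩
    suffices hg : MapClusterPt g atTop fun n => opaOn E n f by
      obtain ⟨m, hm, ht⟩ := hg.tendsto_subseq
      exact ⟨m, hm, (htend _ _).2 ht⟩
    rw [mapClusterPt_iff_frequently]
    intro s hs
    obtain ⟨ε, hε, hεs⟩ := Metric.mem_nhds_iff.1 hs
    obtain ⟨k, hk⟩ := exists_nat_one_div_lt (half_pos hε)
    obtain ⟨_, hj, j, rfl⟩ := Metric.dense_iff.1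
      (TopologicalSpace.denseRange_denseSeq C(E, ℂ)) g (ε / 2) (half_pos hε)
    rw [frequently_atTop]
    intro N
    obtain ⟨n, hn, -, hd⟩ := h (j, k, N)
    refine ⟨n, hn, hεs ?_⟩
    have h1 : dist (opaOn E n f) (TopologicalSpace.denseSeq C(E, ℂ) j) < 1 / ((k : ℝ) + 1) := hd
    rw [mem_ball] at hj ⊢
    linarith [dist_triangle (opaOn E n f) (TopologicalSpace.denseSeq C(E, ℂ) j) g]

/-! ### Density of the approximating sets -/

theorem isNullCompact_image {E : Set Circle} (hE : IsClosed E) (hE0 : arcLength E = 0) :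
    IsNullCompact ((fun z : Circle => (z : ℂ)) '' E) where
  isCompact := hE.isCompact.image (by fun_prop)
  norm_eq_one := by
    rintro _ ⟨z, -, rfl⟩
    exact z.norm_coe
  null := by
    rw [← hE0, arcLength]
    congr 1
    ext t
    refine and_congr_right fun _ => ⟨?_, fun h => ⟨Circle.exp t, h, ?_⟩⟩
    · rintro ⟨z, hz, h⟩
      have : z = Circle.exp t := Circle.ext (by simpa [circleMap] using h)
      rwa [← this]
    · simp [circleMap]

theorem dense_nearOPA {E : Set Circle} [CompactSpace E] (hE : IsClosed E)
    (hE0 : arcLength E = 0) (g : C(E, ℂ)) {ε : ℝ} (hε : 0 < ε) (N : ℕ) :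
    Dense (nearOPA E g ε N) := by
  have hemb : IsClosedEmbedding fun z : E => ((z : Circle) : ℂ) :=
    Continuous.isClosedEmbedding (by fun_prop) fun z w h => Subtype.ext (Circle.ext h)
  -- Tietze extension, since the approximation results concern functions on the plane.
  obtain ⟨G, hG⟩ := g.exists_extension' hemb
  refine Metric.dense_iff.2 fun f r hr => ?_
  obtain ⟨f', hf', hne, Q, n₀, hQ, hQg⟩ := (isNullCompact_image hE hE0).exists_near_isOPA
    G.continuous.continuousOn f hr (half_pos hε)
  refine ⟨f', by rwa [mem_ball, dist_eq_norm], ?_⟩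
  refine Set.mem_iUnion₂.2 ⟨max N n₀, le_max_left _ _, hne, ?_⟩
  -- Uniqueness for `f' ≠ 0` identifies the chosen approximant with `Q`.
  have hopa : opa f' (max N n₀) = Q := (isOPA_opa _ _).unique hne (hQ _ (le_max_right _ _))
  refine (ContinuousMap.dist_le (half_pos hε).le).2 (fun z => ?_) |>.trans_lt (half_lt_self hε)
  have h1 := hQg z ⟨z, z.2, rfl⟩
  have h2 : G z = g z := congrFun hG z
  rw [dist_eq_norm, ← h2]
  change ‖(opa f' (max N n₀)).eval _ - _‖ ≤ _
  rwa [hopa]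

end Hardy

end

theorem theorem1p2 (E : Set Circle) (hE : IsClosed E) (hE0 : Hardy.arcLength E = 0) :
    IsGδ (Hardy.universalOPA E) ∧ Dense (Hardy.universalOPA E) := by
  have : CompactSpace E := isCompact_iff_compactSpace.1 hE.isCompact
  rw [Hardy.universalOPA_eq]
  exact ⟨.iInter_of_isOpen fun i => Hardy.isOpen_nearOPA E _ _ _,
    dense_iInter_of_isOpen (fun i => Hardy.isOpen_nearOPA E _ _ _) fun i =>
      Hardy.dense_nearOPA hE hE0 _ (by positivity) _⟩
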